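/- Let $\mathcal X,\mathcal Y$ be compact metric spaces and let $X,Y$ be random variables on a probability space $(\Omega,\mathscr A,\mathbb P)$ with values in $\mathcal X$ and $\mathcal Y$. Let $\mathcal H_X$, $\mathcal H_Y$ be reproducing kernel Hilbert spaces of real functions on $\mathcal X$, $\mathcal Y$ with kernels $K:\mathcal X^2\to\mathbb R$ and $L:\mathcal Y^2\to\mathbb R$. For $g\in\mathcal H_Y$, $f\in\mathcal H_X$ let $g\otimes f$ be the operator $h\mapsto\langle g,h\rangle_{\mathcal H_Y}f$ from $\mathcal H_Y$ to $\mathcal H_X$, and let $\langle\cdot,\cdot\rangle_{HS}$, $\|\cdot\|_{HS}$ be the Hilbert-Schmidt inner product and norm. Put $m_X=\mathbb E(K(X,\cdot))$, $m_Y=\mathbb E(L(Y,\cdot))$, $\mu=\mathbb E(L(Y,\cdot)\otimes K(X,\cdot))$, $\nu=m_Y\otimes m_X$, and $H=\|\mu-\nu\|_{HS}^2$ (the Hilbert-Schmidt independence criterion). Let $(X_i,Y_i)_{i\ge1}$ be an i.i.d. sequence distributed as $(X,Y)$, $k_{ij}=K(X_i,X_j)$, $\ell_{ij}=L(Y_i,Y_j)$.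 For $\gamma\in(0,1]$ and $r\ge1$ let $w_{1,r}(\gamma),\dots,w_{r,r}(\gamma)$ be positive numbers, let $w(\gamma)$ be a real number for each $\gamma\in(0,1]$, and put $$\widehat H_{n,\gamma}=\frac1{n^2}\sum_{i,j=1}^n k_{ij}\ell_{ij}+\frac1{n^4}\sum_{i,j,q,r=1}^n k_{ij}\ell_{qr}-\frac2{n^3}\sum_{i,j,q=1}^n w_{i,n}(\gamma)\,k_{ij}\ell_{iq}.$$ Define, for $(x,y)\in\mathcal X\times\mathcal Y$, $$\mathcal U(x,y)=\langle L(y,\cdot)\otimes K(x,\cdot)-\mu,\mu\rangle_{HS}+\langle L(y,\cdot)\otimes m_X+m_Y\otimes K(x,\cdot)-2\nu,\nu-\mu\rangle_{HS},$$ $$\mathcal V(x,y)=\langle L(y,\cdot)\otimes K(x,\cdot)-\mu,\nu\rangle_{HS}.$$ **Theorem.** Assume: - (A1) $\sup_{\mathcal X^2}K<\infty$ and $\sup_{\mathcal Y^2}L<\infty$. - (A2) $\mathcal H_X$ and $\mathcal H_Y$ are universal: their kernels are continuous, and each space is dense for the supremum norm in the space of continuous real functions on $\mathcal X$, respectively $\mathcal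 Y$. - (A3) For each $\gamma\in(0,1]$ there are $\tau>0$ and $n_0$ such that $r\left|\frac1r\sum_{i=1}^r w_{i,r}(\gamma)-1\right|\le\tau$ for all $r>n_0$. - (A4) There is $C>0$ such that $\max_{1\le i\le r}w_{i,r}(\gamma)<C$ for all $r\ge1$ and all $\gamma\in(0,1]$. - (A5) For each $\gamma\in(0,1]$, $\lim_{r\to\infty}\frac1r\sum_{i=1}^r w_{i,r}^2(\gamma)=w^2(\gamma)>1$. Then, for every $\gamma\in(0,1]$, as $n\to\infty$, $\sqrt n\,(\widehat H_{n,\gamma}-H)$ converges in distribution to $\mathcal N(0,\sigma_\gamma^2)$, where $$\sigma_\gamma^2=4\,\mathrm{Var}(\mathcal U(X_1,Y_1))+4w^2(\gamma)\,\mathrm{Var}(\mathcal V(X_1,Y_1))-8\,\mathrm{Cov}(\mathcal U(X_1,Y_1),\mathcal V(X_1,Y_1)).$$ In particular this quantity is nonnegative; if it is $0$, the limit law is the point mass at $0$. -/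

import Mathlib

open MeasureTheory ProbabilityTheory Filter Topology
open scoped NNReal ENNReal InnerProductSpace

noncomputable section

/-! ### Hilbert-Schmidt operators between real Hilbert spaces -/

section HilbertSchmidt

variable {E F : Type*} [NormedAddCommGroup E] [InnerProductSpace ℝ E] [CompleteSpace E]
  [NormedAddCommGroup F] [InnerProductSpace ℝ F]

variable (E) in
/-- The index set of a fixed Hilbert basis of `E`. -/
def hsIndex : Set E := (exists_hilbertBasis ℝ E).choose

variable (E) in
/-- A fixed Hilbert basis of `E`. Nothing below depends on its choice:
see `HSOp.hasSum_inner_of_basis`. -/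
def hsBasis : HilbertBasis (hsIndex E) ℝ E := (exists_hilbertBasis ℝ E).choose_spec.choose

/-- A bounded operator `T` is Hilbert-Schmidt if `∑ i, ‖T eᵢ‖ ^ 2 < ∞` for a Hilbert basis `e`. -/
def IsHilbertSchmidt (T : E →L[ℝ] F) : Prop :=
  Summable fun i : hsIndex E => ‖T (hsBasis E i)‖ ^ 2

theorem IsHilbertSchmidt.summable_inner {S T : E →L[ℝ] F} (hS : IsHilbertSchmidt S)
    (hT : IsHilbertSchmidt T) :
    Summable fun i : hsIndex E => ⟪S (hsBasis E i), T (hsBasis E i)⟫_ℝ := by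
  refine Summable.of_norm_bounded (hS.add hT) fun i => ?_
  refine (norm_inner_le_norm _ _).trans ?_
  nlinarith [sq_nonneg (‖S (hsBasis E i)‖ - ‖T (hsBasis E i)‖),
    sq_nonneg ‖S (hsBasis E i)‖, sq_nonneg ‖T (hsBasis E i)‖]

variable (E F)

/-- The subspace of Hilbert-Schmidt operators inside the space of bounded operators. -/
def hsSubmodule : Submodule ℝ (E →L[ℝ] F) where
  carrier := {T | IsHilbertSchmidt T}
  zero_mem' := by simp [IsHilbertSchmidt, summable_zero]
  add_mem' {S T} hS hT := by
    have h := (hS.add hT).add ((IsHilbertSchmidt.summable_inner hS hT).mul_left 2)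
    refine h.congr fun i => ?_
    simp only [add_apply]
    rw [norm_add_sq_real]; ring
  smul_mem' c T hT := by
    refine (hT.mul_left (c ^ 2)).congr fun i => ?_
    simp [norm_smul, mul_pow]

/-- The type of Hilbert-Schmidt operators from `E` to `F`. It is not reducible to a submodule of
`E →L[ℝ] F`, since it carries the Hilbert-Schmidt norm instead of the operator norm. -/
def HSOp : Type _ := hsSubmodule E F

namespace HSOp

instance : AddCommGroup (HSOp E F) := inferInstanceAs (AddCommGroup (hsSubmodule E F))

instance : Module ℝ (HSOp E F) := inferInstanceAs (Module ℝ (hsSubmodule E F))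

/-- The underlying bounded operator, linearly. -/
def toCLM : HSOp E F →ₗ[ℝ] (E →L[ℝ] F) := (hsSubmodule E F).subtype

variable {E F}

theorem toCLM_injective : Function.Injective (toCLM E F) := Subtype.val_injective

theorem isHilbertSchmidt (T : HSOp E F) : IsHilbertSchmidt (toCLM E F T) := T.2

/-- The bundling of a Hilbert-Schmidt operator. -/
def mk (T : E →L[ℝ] F) (hT : IsHilbertSchmidt T) : HSOp E F := ⟨T, hT⟩

@[simp] theorem toCLM_mk (T : E →L[ℝ] F) (hT : IsHilbertSchmidt T) : toCLM E F (mk T hT) = T := rfl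

/-- An operator that vanishes on a Hilbert basis is zero. -/
theorem clm_eq_zero {T : E →L[ℝ] F} (h : ∀ i, T (hsBasis E i) = 0) : T = 0 := by
  have hd : Dense (Submodule.span ℝ (Set.range (hsBasis E)) : Set E) :=
    Submodule.dense_iff_topologicalClosure_eq_top.2 (hsBasis E).dense_span
  refine ContinuousLinearMap.ext_on hd ?_
  rintro _ ⟨i, rfl⟩
  simpa using h i

/-- The Hilbert-Schmidt inner product `⟪S, T⟫ = ∑ i, ⟪S eᵢ, T eᵢ⟫`. -/
abbrev core : InnerProductSpace.Core ℝ (HSOp E F) where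
  inner S T := ∑' i : hsIndex E, ⟪toCLM E F S (hsBasis E i), toCLM E F T (hsBasis E i)⟫_ℝ
  conj_inner_symm S T := by
    simp only [conj_trivial]
    exact tsum_congr fun i => real_inner_comm _ _
  re_inner_nonneg S := by
    simp only [RCLike.re_to_real]
    exact tsum_nonneg fun i => real_inner_self_nonneg
  add_left S T U := by
    simp only [map_add, add_apply, inner_add_left]
    exact (S.isHilbertSchmidt.summable_inner U.isHilbertSchmidt).tsum_add
      (T.isHilbertSchmidt.summable_inner U.isHilbertSchmidt)
  smul_left S T r := by
    simp only [map_smul, smul_apply, real_inner_smul_left, conj_trivial]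
    exact tsum_mul_left
  definite S hS := by
    have h1 := S.isHilbertSchmidt.summable_inner S.isHilbertSchmidt
    have h2 : HasSum (fun i : hsIndex E =>
        ⟪toCLM E F S (hsBasis E i), toCLM E F S (hsBasis E i)⟫_ℝ) 0 := hS ▸ h1.hasSum
    have h3 := (hasSum_zero_iff_of_nonneg fun i => real_inner_self_nonneg).1 h2
    refine toCLM_injective ?_
    rw [map_zero]
    exact clm_eq_zero fun i => inner_self_eq_zero.1 (congrFun h3 i)

instance : NormedAddCommGroup (HSOp E F) :=
  InnerProductSpace.Core.toNormedAddCommGroup (𝕜 := ℝ) (cd := core)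

instance : InnerProductSpace ℝ (HSOp E F) := InnerProductSpace.ofCore core.toCore

theorem inner_def (S T : HSOp E F) :
    ⟪S, T⟫_ℝ = ∑' i : hsIndex E, ⟪toCLM E F S (hsBasis E i), toCLM E F T (hsBasis E i)⟫_ℝ := rfl

theorem hasSum_norm_sq (T : HSOp E F) :
    HasSum (fun i : hsIndex E => ‖toCLM E F T (hsBasis E i)‖ ^ 2) (‖T‖ ^ 2) := by
  rw [← real_inner_self_eq_norm_sq, inner_def]
  simp only [real_inner_self_eq_norm_sq]
  exact T.isHilbertSchmidt.hasSum

/-! Completeness, by identification with the square summable families `(T eᵢ)`. -/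

theorem memlp (T : HSOp E F) :
    Memℓp (fun i : hsIndex E => toCLM E F T (hsBasis E i)) 2 := by
  refine memℓp_gen ?_
  refine T.isHilbertSchmidt.congr fun i => ?_
  simp

/-- A Hilbert-Schmidt operator as the square summable family of its values on the basis. -/
def toLp : HSOp E F →ₗᵢ[ℝ] lp (fun _ : hsIndex E => F) 2 where
  toFun T := ⟨fun i => toCLM E F T (hsBasis E i), memlp T⟩
  map_add' S T := by
    ext i
    exact congrArg (fun A : E →L[ℝ] F => A (hsBasis E i)) (map_add (toCLM E F) S T)
  map_smul' c T := by
    ext i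
    exact congrArg (fun A : E →L[ℝ] F => A (hsBasis E i)) (map_smul (toCLM E F) c T)
  norm_map' T := by
    refine (sq_eq_sq₀ (norm_nonneg _) (norm_nonneg _)).1 ?_
    rw [← real_inner_self_eq_norm_sq, ← real_inner_self_eq_norm_sq]
    rfl

theorem toLp_surjective [CompleteSpace F] :
    Function.Surjective (toLp : HSOp E F →ₗᵢ[ℝ] lp (fun _ : hsIndex E => F) 2) := by
  intro x
  have hx : Summable fun i => ‖x i‖ ^ 2 := by
    simpa using (lp.memℓp x).summable (by norm_num)
  have hE : ∀ v : E, HasSum (fun i => |⟪hsBasis E i, v⟫_ℝ| ^ 2) (‖v‖ ^ 2) := fun v => by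
    have h := (hsBasis E).hasSum_inner_mul_inner v v
    rw [real_inner_self_eq_norm_sq] at h
    refine h.congr_fun fun i => ?_
    rw [sq_abs, real_inner_comm v, sq]
  have hcs : ∀ v : E, (Summable fun i => |⟪hsBasis E i, v⟫_ℝ| * ‖x i‖) ∧
      ∑' i, |⟪hsBasis E i, v⟫_ℝ| * ‖x i‖ ≤ ‖v‖ * √(∑' i, ‖x i‖ ^ 2) := fun v => by
    have h := Real.summable_and_inner_le_Lp_mul_Lq_tsum_of_nonneg
      (f := fun i => |⟪hsBasis E i, v⟫_ℝ|) (g := fun i => ‖x i‖) (p := 2) (q := 2)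
      ⟨by norm_num, by norm_num, by norm_num⟩ (fun i => abs_nonneg _) (fun i => norm_nonneg _)
      (by simpa only [Real.rpow_two] using (hE v).summable)
      (by simpa only [Real.rpow_two] using hx)
    simp only [Real.rpow_two, ← Real.sqrt_eq_rpow] at h
    rwa [(hE v).tsum_eq, Real.sqrt_sq (norm_nonneg _)] at h
  have hs : ∀ v : E, Summable fun i => ⟪hsBasis E i, v⟫_ℝ • x i := fun v =>
    Summable.of_norm ((hcs v).1.congr fun i => by rw [norm_smul, Real.norm_eq_abs])
  let T : E →L[ℝ] F := LinearMap.mkContinuous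
    { toFun := fun v => ∑' i, ⟪hsBasis E i, v⟫_ℝ • x i
      map_add' := fun u v => by
        simp only [inner_add_right, add_smul]
        exact (hs u).tsum_add (hs v)
      map_smul' := fun c v => by
        simp only [real_inner_smul_right, mul_smul, RingHom.id_apply]
        exact (hs v).tsum_const_smul c }
    (√(∑' i, ‖x i‖ ^ 2)) (fun v => by
      refine (norm_tsum_le_tsum_norm
        ((hcs v).1.congr fun i => by rw [norm_smul, Real.norm_eq_abs])).trans ?_
      simp only [norm_smul, Real.norm_eq_abs]
      rw [mul_comm]
      exact (hcs v).2)
  have hT : ∀ j, T (hsBasis E j) = x j := fun j => by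
    change ∑' i, ⟪hsBasis E i, hsBasis E j⟫_ℝ • x i = x j
    rw [tsum_eq_single j]
    · rw [real_inner_self_eq_norm_sq, (hsBasis E).orthonormal.1 j]; simp
    · intro i hij
      rw [(hsBasis E).orthonormal.2 hij, zero_smul]
  refine ⟨mk T (by simpa only [IsHilbertSchmidt, hT] using hx), ?_⟩
  ext i
  exact hT i

instance [CompleteSpace F] : CompleteSpace (HSOp E F) := 
  ((LinearIsometryEquiv.ofSurjective toLp toLp_surjective).toIsometryEquiv.completeSpace)

/-- The tensor product `g ⊗ f : h ↦ ⟪g, h⟫ f` as a Hilbert-Schmidt operator. -/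
def tensor (g : E) (f : F) : HSOp E F :=
  mk ((innerSL ℝ g).smulRight f) (by
    have h := ((hsBasis E).summable_inner_mul_inner g g).mul_right (‖f‖ ^ 2)
    refine h.congr fun i => ?_
    simp only [ContinuousLinearMap.smulRight_apply, innerSL_apply_apply, norm_smul, mul_pow,
      Real.norm_eq_abs, sq_abs]
    rw [real_inner_comm g (hsBasis E i)]; ring)

theorem tensor_apply (g : E) (f : F) (h : E) : toCLM E F (tensor g f) h = ⟪g, h⟫_ℝ • f := rfl

section basis

variable [CompleteSpace F]

theorem ofReal_tsum_inner_sq {G ι : Type*} [NormedAddCommGroup G] [InnerProductSpace ℝ G]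
    (b : HilbertBasis ι ℝ G) (v : G) :
    ∑' i, ENNReal.ofReal (⟪b i, v⟫_ℝ ^ 2) = ENNReal.ofReal (‖v‖ ^ 2) := by
  have h := b.hasSum_inner_mul_inner v v
  rw [real_inner_self_eq_norm_sq] at h
  rw [← h.tsum_eq, ENNReal.ofReal_tsum_of_nonneg (fun i => ?_) h.summable]
  · exact tsum_congr fun i => by rw [real_inner_comm v, sq]
  · rw [real_inner_comm v]; exact mul_self_nonneg _

theorem tsum_basis_eq_adjoint {ι κ : Type*} (b : HilbertBasis ι ℝ E) (c : HilbertBasis κ ℝ F)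
    (T : E →L[ℝ] F) :
    ∑' i, ENNReal.ofReal (‖T (b i)‖ ^ 2) =
      ∑' j, ENNReal.ofReal (‖ContinuousLinearMap.adjoint T (c j)‖ ^ 2) := by
  simp only [← ofReal_tsum_inner_sq c, ← ofReal_tsum_inner_sq b]
  rw [ENNReal.tsum_comm]
  refine tsum_congr fun j => tsum_congr fun i => ?_
  rw [ContinuousLinearMap.adjoint_inner_right, real_inner_comm]

/-- The Hilbert-Schmidt norm can be computed in any Hilbert basis. -/
theorem hasSum_norm_sq_of_basis {ι : Type*} (b : HilbertBasis ι ℝ E) (T : HSOp E F) :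
    HasSum (fun i => ‖toCLM E F T (b i)‖ ^ 2) (‖T‖ ^ 2) := by
  have h := tsum_basis_eq_adjoint (hsBasis E) (hsBasis F) (toCLM E F T)
  rw [← tsum_basis_eq_adjoint b (hsBasis F) (toCLM E F T),
    ← ENNReal.ofReal_tsum_of_nonneg (fun i => sq_nonneg _) T.hasSum_norm_sq.summable,
    T.hasSum_norm_sq.tsum_eq] at h
  have hs : Summable fun i => ‖toCLM E F T (b i)‖ ^ 2 := by
    have h' := ENNReal.summable_toReal (h ▸ ENNReal.ofReal_ne_top)
    refine h'.congr fun i => ?_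
    exact ENNReal.toReal_ofReal (sq_nonneg _)
  rw [← ENNReal.ofReal_tsum_of_nonneg (fun i => sq_nonneg _) hs,
    ENNReal.ofReal_eq_ofReal_iff (sq_nonneg _) (tsum_nonneg fun i => sq_nonneg _)] at h
  rw [h]
  exact hs.hasSum

/-- The Hilbert-Schmidt inner product can be computed in any Hilbert basis. -/
theorem hasSum_inner_of_basis {ι : Type*} (b : HilbertBasis ι ℝ E) (S T : HSOp E F) :
    HasSum (fun i => ⟪toCLM E F S (b i), toCLM E F T (b i)⟫_ℝ) ⟪S, T⟫_ℝ := by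
  have h := ((hasSum_norm_sq_of_basis b (S + T)).sub
    ((hasSum_norm_sq_of_basis b S).add (hasSum_norm_sq_of_basis b T))).div_const 2
  have e : ⟪S, T⟫_ℝ = (‖S + T‖ ^ 2 - (‖S‖ ^ 2 + ‖T‖ ^ 2)) / 2 := by
    rw [norm_add_sq_real]; ring
  rw [e]
  refine h.congr_fun fun i => ?_
  rw [map_add, add_apply, norm_add_sq_real]; ring

end basis

end HSOp

end HilbertSchmidt

/-! ### Reproducing kernels, the Hilbert-Schmidt independence criterion and its estimator -/

section HSIC

section kernel

variable (H : Type*) {𝒳 : Type*} [NormedAddCommGroup H] [InnerProductSpace ℝ H] [CompleteSpace H]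
  [RKHS ℝ H 𝒳 ℝ]

/-- The element `K(x, ·)` of the reproducing kernel Hilbert space `H`. -/
def kernelSection (x : 𝒳) : H := RKHS.kerFun H x (1 : ℝ)

/-- The reproducing kernel `K : 𝒳 × 𝒳 → ℝ` of `H`. -/
def scalarKernel (x x' : 𝒳) : ℝ := kernelSection H x x'

theorem inner_kernelSection (x : 𝒳) (f : H) : ⟪kernelSection H x, f⟫_ℝ = f x := by
  simp [kernelSection]

/-- `H` is universal: its kernel is continuous and `H` is dense, for the supremum norm, in the
space of continuous real functions. (A continuous kernel makes all elements of `H` continuous.) -/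
def IsUniversalRKHS [TopologicalSpace 𝒳] : Prop :=
  Continuous (fun p : 𝒳 × 𝒳 => scalarKernel H p.1 p.2) ∧
    ∀ f : C(𝒳, ℝ), ∀ ε > 0, ∃ h : H, ∀ x, |h x - f x| < ε

/-- The kernel mean embedding `𝔼 (K(X, ·))`, a Bochner integral in `H`. -/
def meanEmbedding {Ω : Type*} [MeasurableSpace Ω] (P : Measure Ω) (X : Ω → 𝒳) : H :=
  ∫ ω, kernelSection H (X ω) ∂P

end kernel

section criterion

variable {Ω 𝒳 𝒴 : Type*} [MeasurableSpace Ω] (P : Measure Ω)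
  (HX HY : Type*)
  [NormedAddCommGroup HX] [InnerProductSpace ℝ HX] [CompleteSpace HX] [RKHS ℝ HX 𝒳 ℝ]
  [NormedAddCommGroup HY] [InnerProductSpace ℝ HY] [CompleteSpace HY] [RKHS ℝ HY 𝒴 ℝ]
  (X : Ω → 𝒳) (Y : Ω → 𝒴)

/-- `μ = 𝔼 (L(Y, ·) ⊗ K(X, ·))`, a Bochner integral in the space of Hilbert-Schmidt operators. -/
def hsicMu : HSOp HY HX :=
  ∫ ω, HSOp.tensor (kernelSection HY (Y ω)) (kernelSection HX (X ω)) ∂P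

/-- `ν = m_Y ⊗ m_X`. -/
def hsicNu : HSOp HY HX := HSOp.tensor (meanEmbedding HY P Y) (meanEmbedding HX P X)

/-- The Hilbert-Schmidt independence criterion of `X` and `Y`. -/
def hsic : ℝ := ‖hsicMu P HX HY X Y - hsicNu P HX HY X Y‖ ^ 2

/-- The function `𝒰` on `𝒳 × 𝒴`. -/
def hsicU (x : 𝒳) (y : 𝒴) : ℝ :=
  ⟪HSOp.tensor (kernelSection HY y) (kernelSection HX x) - hsicMu P HX HY X Y,
    hsicMu P HX HY X Y⟫_ℝ +
  ⟪HSOp.tensor (kernelSection HY y) (meanEmbedding HX P X) +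
      HSOp.tensor (meanEmbedding HY P Y) (kernelSection HX x) - (2 : ℝ) • hsicNu P HX HY X Y,
    hsicNu P HX HY X Y - hsicMu P HX HY X Y⟫_ℝ

/-- The function `𝒱` on `𝒳 × 𝒴`. -/
def hsicV (x : 𝒳) (y : 𝒴) : ℝ :=
  ⟪HSOp.tensor (kernelSection HY y) (kernelSection HX x) - hsicMu P HX HY X Y,
    hsicNu P HX HY X Y⟫_ℝ

end criterion

/-- The weighted estimator of the criterion, for kernels `K`, `L`, weights `w` and a sample
`(x i, y i)` of size `n`. -/
def hsicEstimator {𝒳 𝒴 : Type*} (K : 𝒳 → 𝒳 → ℝ) (L : 𝒴 → 𝒴 → ℝ) {n : ℕ} (w : Fin n → ℝ)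
    (x : Fin n → 𝒳) (y : Fin n → 𝒴) : ℝ :=
  1 / (n : ℝ) ^ 2 * ∑ i, ∑ j, K (x i) (x j) * L (y i) (y j) +
  1 / (n : ℝ) ^ 4 * ∑ i, ∑ j, ∑ q, ∑ r, K (x i) (x j) * L (y q) (y r) -
  2 / (n : ℝ) ^ 3 * ∑ i, ∑ j, ∑ q, w i * K (x i) (x j) * L (y i) (y q)

end HSIC

end

/-!
The estimator is the plug-in expression `‖μ̂‖² + ‖ν̂‖² - 2 ⟪μ̂_w, ν̂⟫`, in which `μ̂` is the average of
`Zᵢ = L(Yᵢ, ·) ⊗ K(Xᵢ, ·)`, `μ̂_w` their weighted average, and `ν̂` the tensor product of the averages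
of `L(Yᵢ, ·)` and `K(Xᵢ, ·)` (`hsicEstimator_eq`). Expand it to first order around the population
quantities. As the tensor product is bilinear with `‖g ⊗ f‖ = ‖g‖ ‖f‖`, the linear part is exactly
the average of `2 (𝒰(Xᵢ, Yᵢ) - wᵢ 𝒱(Xᵢ, Yᵢ))`, and the remainder is bounded, for every sample, by a
constant times the squared norms of the centred (weighted) averages plus the deviation of the mean
of the weights from `1` (`abs_hsicEstimator_sub_average_le`).

The features are continuous on compact spaces, hence bounded, and distinct observations give
orthogonal centred features in `L²`. Thus the squared norms have expectation `O(1 / n)`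
(`integral_norm_sq_average_le`), the deviation of the weights is `O(1 / n)` by assumption, and `√n`
times the remainder tends to `0` in `L¹` (`tendstoInMeasure_hsicEstimator_sub_average`).

The linear part is a normalized sum of bounded centred independent variables which are not
identically distributed, because of the weights. Their variances
`4 Var 𝒰 + 4 wᵢ² Var 𝒱 - 8 wᵢ Cov(𝒰, 𝒱)` average to the asserted limit, and a central limit theorem
for bounded triangular arrays applies (`tendstoInDistribution_inv_sqrt_mul_sum_of_bounded`). It is
proved with Lévy's theorem: the characteristic function of each summand is compared with that of the
Gaussian of the same variance, up to an error of order `n ^ (-3/2)`, and the errors of the `n` factors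
add up. Slutsky's lemma combines the two parts.
-/

/-! ### A central limit theorem for bounded triangular arrays -/

/-- A telescoping bound for the difference of two products of numbers of the unit disc. -/
theorem norm_prod_sub_prod_le_sum {ι : Type*} (s : Finset ι) (a b : ι → ℂ)
    (ha : ∀ i ∈ s, ‖a i‖ ≤ 1) (hb : ∀ i ∈ s, ‖b i‖ ≤ 1) :
    ‖∏ i ∈ s, a i - ∏ i ∈ s, b i‖ ≤ ∑ i ∈ s, ‖a i - b i‖ := by
  classical
  induction s using Finset.induction_on with
  | empty => simp
  | insert j s hj ih =>
    rw [Finset.prod_insert hj, Finset.prod_insert hj, Finset.sum_insert hj]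
    have h1 := ih (fun i hi => ha i (Finset.mem_insert_of_mem hi))
      (fun i hi => hb i (Finset.mem_insert_of_mem hi))
    have h2 : ‖∏ i ∈ s, a i‖ ≤ 1 := by
      rw [norm_prod]
      exact Finset.prod_le_one (fun i _ => norm_nonneg _)
        fun i hi => ha i (Finset.mem_insert_of_mem hi)
    have e : a j * ∏ i ∈ s, a i - b j * ∏ i ∈ s, b i =
        (a j - b j) * ∏ i ∈ s, a i + b j * (∏ i ∈ s, a i - ∏ i ∈ s, b i) := by ring
    rw [e]
    refine (norm_add_le _ _).trans ?_
    rw [norm_mul, norm_mul]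
    have h3 := mul_le_mul_of_nonneg_left h2 (norm_nonneg (a j - b j))
    have h4 := mul_le_mul_of_nonneg_right (hb j (Finset.mem_insert_self j s))
      (norm_nonneg (∏ i ∈ s, a i - ∏ i ∈ s, b i))
    linarith

section clt

variable {Ω : Type*} [MeasurableSpace Ω] {P : Measure Ω} [IsProbabilityMeasure P]

/-- The characteristic function of a bounded centred variable agrees to third order with that of
the Gaussian of the same variance. -/
theorem norm_charFun_sub_exp_le {ξ : Ω → ℝ} (hξ : AEMeasurable ξ P) {M : ℝ}
    (hM : ∀ ω, |ξ ω| ≤ M) (h0 : ∫ ω, ξ ω ∂P = 0) {s : ℝ} (hs : |s| * M ≤ 1) :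
    ‖charFun (P.map ξ) s - Complex.exp (-(s ^ 2 * Var[ξ; P] / 2 : ℝ))‖ ≤ 2 * (|s| * M) ^ 3 := by
  have hM0 : 0 ≤ M := by
    obtain ⟨ω⟩ : Nonempty Ω := nonempty_of_isProbabilityMeasure P
    exact (abs_nonneg _).trans (hM ω)
  have hint : Integrable ξ P := Integrable.of_bound hξ.aestronglyMeasurable M (ae_of_all _ hM)
  have hsq : ∀ ω, ξ ω ^ 2 ≤ M ^ 2 := fun ω => sq_le_sq' (neg_le_of_abs_le (hM ω)) (le_of_abs_le (hM ω))
  have hint2 : Integrable (fun ω => ξ ω ^ 2) P :=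
    Integrable.of_bound (hξ.pow_const 2).aestronglyMeasurable (M ^ 2)
      (ae_of_all _ fun ω => by
        rw [Real.norm_eq_abs, abs_of_nonneg (sq_nonneg _)]; exact hsq ω)
  have hv : Var[ξ; P] = ∫ ω, ξ ω ^ 2 ∂P := variance_of_integral_eq_zero hξ h0
  have hv0 : 0 ≤ Var[ξ; P] := variance_nonneg _ _
  have hvM : Var[ξ; P] ≤ M ^ 2 := by
    rw [hv]
    have := integral_mono hint2 (integrable_const (M ^ 2)) hsq
    simpa using this
  set a : ℝ := |s| * M with ha
  have ha0 : 0 ≤ a := by positivity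
  have hsv : s ^ 2 * Var[ξ; P] ≤ a ^ 2 := by
    rw [ha, mul_pow, sq_abs]; gcongr
  -- the second order expansion of the characteristic function
  have h1 : ‖charFun (P.map ξ) s - ((1 - s ^ 2 * Var[ξ; P] / 2 : ℝ) : ℂ)‖ ≤ a ^ 3 := by
    have e1 : charFun (P.map ξ) s = ∫ ω, Complex.exp (s * ξ ω * Complex.I) ∂P := by
      rw [charFun_apply_real, integral_map hξ (by fun_prop)]
    have e3 : ∀ ω, ((s : ℂ) * ξ ω * Complex.I) ^ 2 / 2 =
        (-(s : ℂ) ^ 2 / 2) * ((ξ ω ^ 2 : ℝ) : ℂ) := fun ω => by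
      rw [mul_pow, Complex.I_sq]; push_cast; ring
    have i1 : Integrable (fun ω => (s : ℂ) * ξ ω * Complex.I) P :=
      (hint.ofReal.const_mul _).mul_const _
    have i2 : Integrable (fun ω => 1 + (s : ℂ) * ξ ω * Complex.I) P := (integrable_const _).add i1
    have i3 : Integrable (fun ω => (-(s : ℂ) ^ 2 / 2) * ((ξ ω ^ 2 : ℝ) : ℂ)) P :=
      hint2.ofReal.const_mul _
    have e2 : ((1 - s ^ 2 * Var[ξ; P] / 2 : ℝ) : ℂ) =
        ∫ ω, (1 + (s : ℂ) * ξ ω * Complex.I + (s * ξ ω * Complex.I) ^ 2 / 2) ∂P := by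
      simp only [e3]
      rw [integral_add i2 i3, integral_add (integrable_const _) i1, integral_const_mul,
        integral_mul_const, integral_const_mul, integral_complex_ofReal, integral_complex_ofReal,
        h0, ← hv]
      simp; ring
    have hexp : Integrable (fun ω => Complex.exp (s * ξ ω * Complex.I)) P := by
      refine Integrable.of_bound (by fun_prop) 1 (ae_of_all _ fun ω => ?_)
      rw [← Complex.ofReal_mul, Complex.norm_exp_ofReal_mul_I]
    have hpol : Integrable
        (fun ω => 1 + (s : ℂ) * ξ ω * Complex.I + (s * ξ ω * Complex.I) ^ 2 / 2) P := by
      simp only [e3]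
      exact i2.add i3
    rw [e1, e2, ← integral_sub hexp hpol]
    refine (norm_integral_le_of_norm_le_const (C := a ^ 3) (ae_of_all _ fun ω => ?_)).trans (by simp)
    have hn : ‖(s : ℂ) * ξ ω * Complex.I‖ ≤ a := by
      simp only [norm_mul, Complex.norm_I, mul_one, Complex.norm_real, Real.norm_eq_abs, ha]
      exact mul_le_mul_of_nonneg_left (hM ω) (abs_nonneg _)
    have h := Complex.exp_bound (hn.trans hs) (n := 3) (by norm_num)
    have e4 : ∑ m ∈ Finset.range 3, ((s : ℂ) * ξ ω * Complex.I) ^ m / m.factorial =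
        1 + (s : ℂ) * ξ ω * Complex.I + (s * ξ ω * Complex.I) ^ 2 / 2 := by
      simp [Finset.sum_range_succ, Nat.factorial]
    rw [e4] at h
    refine h.trans ?_
    have h5 : ‖(s : ℂ) * ξ ω * Complex.I‖ ^ 3 ≤ a ^ 3 := by gcongr
    have h6 : ((Nat.succ 3 : ℕ) : ℝ) * ((Nat.factorial 3 : ℝ) * (3 : ℕ))⁻¹ ≤ 1 := by
      norm_num [Nat.factorial]
    calc _ ≤ a ^ 3 * 1 := mul_le_mul h5 h6 (by positivity) (by positivity)
      _ = a ^ 3 := mul_one _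
  -- the first order expansion of the Gaussian characteristic function
  have h2 : ‖((1 - s ^ 2 * Var[ξ; P] / 2 : ℝ) : ℂ) -
      Complex.exp (-(s ^ 2 * Var[ξ; P] / 2 : ℝ))‖ ≤ a ^ 3 := by
    set y : ℝ := s ^ 2 * Var[ξ; P] / 2 with hy
    have hy0 : 0 ≤ y := by positivity
    have hya : y ≤ a ^ 2 / 2 := by rw [hy]; linarith
    have ha1 : a ^ 2 ≤ 1 := by nlinarith
    have h := Complex.norm_exp_sub_one_sub_id_le (x := ((-y : ℝ) : ℂ)) (by
      rw [Complex.norm_real, Real.norm_eq_abs, abs_neg, abs_of_nonneg hy0]; linarith)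
    rw [Complex.norm_real, Real.norm_eq_abs, abs_neg, abs_of_nonneg hy0] at h
    have e : ((1 - y : ℝ) : ℂ) - Complex.exp (-(y : ℝ)) =
        -(Complex.exp ((-y : ℝ) : ℂ) - 1 - ((-y : ℝ) : ℂ)) := by push_cast; ring
    rw [e, norm_neg]
    refine h.trans ?_
    have h7 : y ^ 2 ≤ (a ^ 2 / 2) ^ 2 := by gcongr
    have h8 : a ^ 4 ≤ a ^ 3 := pow_le_pow_of_le_one ha0 hs (by norm_num)
    have h9 : 0 ≤ a ^ 4 := by positivity
    calc y ^ 2 ≤ (a ^ 2 / 2) ^ 2 := h7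
      _ = a ^ 4 / 4 := by ring
      _ ≤ a ^ 3 := by linarith
  calc _ ≤ _ := norm_sub_le_norm_sub_add_norm_sub _ ((1 - s ^ 2 * Var[ξ; P] / 2 : ℝ) : ℂ) _
    _ ≤ a ^ 3 + a ^ 3 := add_le_add h1 h2
    _ = 2 * a ^ 3 := by ring

/-- The central limit theorem for a uniformly bounded, centred triangular array with independent
rows, the averages of whose variances converge. -/
theorem tendstoInDistribution_inv_sqrt_mul_sum_of_bounded {ξ : (n : ℕ) → Fin n → Ω → ℝ}
    (hξ : ∀ n i, Measurable (ξ n i)) (hindep : ∀ n, iIndepFun (ξ n) P) {M : ℝ}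
    (hM : ∀ n i ω, |ξ n i ω| ≤ M) (h0 : ∀ n i, ∫ ω, ξ n i ω ∂P = 0) {v : ℝ≥0}
    (hv : Tendsto (fun n : ℕ => (n : ℝ)⁻¹ * ∑ i, Var[ξ n i; P]) atTop (𝓝 v)) :
    TendstoInDistribution (fun (n : ℕ) ω => (√(n : ℝ))⁻¹ * ∑ i, ξ n i ω) atTop (id : ℝ → ℝ)
      (fun _ => P) (gaussianReal 0 v) where
  forall_aemeasurable n :=
    ((Finset.measurable_fun_sum _ fun i _ => hξ n i).const_mul _).aemeasurable
  tendsto := by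
    have hM0 : 0 ≤ M := by
      obtain ⟨ω⟩ : Nonempty Ω := nonempty_of_isProbabilityMeasure P
      exact (abs_nonneg _).trans (hM 1 0 ω)
    refine ProbabilityMeasure.tendsto_iff_tendsto_charFun.2 fun t => ?_
    simp only [ProbabilityMeasure.coe_mk, Measure.map_id, charFun_gaussianReal]
    have hchar : ∀ n : ℕ, charFun (P.map fun ω => (√(n : ℝ))⁻¹ * ∑ i, ξ n i ω) t =
        ∏ i, charFun (P.map (ξ n i)) ((√(n : ℝ))⁻¹ * t) := fun n => by
      rw [charFun_map_mul_comp (Finset.aemeasurable_fun_sum _ fun i _ => (hξ n i).aemeasurable),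
        (hindep n).charFun_map_fun_sum_eq_prod fun i => (hξ n i).aemeasurable,
        Finset.prod_apply]
    simp only [hchar]
    have hsq : Tendsto (fun n : ℕ => √(n : ℝ)) atTop atTop :=
      Real.tendsto_sqrt_atTop.comp tendsto_natCast_atTop_atTop
    have hgauss : Tendsto (fun n : ℕ => ∏ i : Fin n,
        Complex.exp (-(((√(n : ℝ))⁻¹ * t) ^ 2 * Var[ξ n i; P] / 2 : ℝ))) atTop
        (𝓝 (Complex.exp (t * (0 : ℝ) * Complex.I - (v : ℝ) * t ^ 2 / 2))) := by
      have e : ∀ n : ℕ, ∏ i : Fin n,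
          Complex.exp (-(((√(n : ℝ))⁻¹ * t) ^ 2 * Var[ξ n i; P] / 2 : ℝ)) =
          Complex.exp (((-(t ^ 2 / 2) * ((n : ℝ)⁻¹ * ∑ i, Var[ξ n i; P]) : ℝ)) : ℂ) := fun n => by
        have r : -(t ^ 2 / 2) * ((n : ℝ)⁻¹ * ∑ i, Var[ξ n i; P]) =
            -∑ i, ((√(n : ℝ))⁻¹ * t) ^ 2 * Var[ξ n i; P] / 2 := by
          rw [← Finset.sum_div, ← Finset.mul_sum, mul_pow, inv_pow,
            Real.sq_sqrt (Nat.cast_nonneg n)]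
          ring
        rw [← Complex.exp_sum, r, Finset.sum_neg_distrib, Complex.ofReal_neg, Complex.ofReal_sum]
      simp only [e]
      have h := (Complex.continuous_exp.comp Complex.continuous_ofReal).tendsto _ |>.comp
        (hv.const_mul (-(t ^ 2 / 2)))
      convert h using 2
      simp only [Function.comp]
      congr 1
      push_cast; ring
    refine tendsto_of_tendsto_of_dist hgauss ?_
    have hbound : Tendsto (fun n : ℕ => 2 * (|t| * M) ^ 3 * (√(n : ℝ))⁻¹) atTop (𝓝 0) := by
      simpa using hsq.inv_tendsto_atTop.const_mul (2 * (|t| * M) ^ 3)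
    refine squeeze_zero' (.of_forall fun n => dist_nonneg) ?_ hbound
    filter_upwards [hsq.eventually_ge_atTop (|t| * M), eventually_ge_atTop 1] with n hn hn1
    have hpos : 0 < √(n : ℝ) := Real.sqrt_pos.2 (by exact_mod_cast hn1)
    have habs : |(√(n : ℝ))⁻¹ * t| * M = (√(n : ℝ))⁻¹ * (|t| * M) := by
      rw [abs_mul, abs_of_pos (inv_pos.2 hpos), mul_assoc]
    have hsmall : |(√(n : ℝ))⁻¹ * t| * M ≤ 1 := by
      rw [habs, inv_mul_le_iff₀ hpos, mul_one]; exact hn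
    rw [dist_comm, dist_eq_norm]
    refine (norm_prod_sub_prod_le_sum _ _ _ (fun i _ => ?_) fun i _ => ?_).trans ?_
    · have := Measure.isProbabilityMeasure_map (hξ n i).aemeasurable (μ := P)
      exact norm_charFun_le_one _
    · rw [← Complex.ofReal_neg, Complex.norm_exp_ofReal, Real.exp_le_one_iff, neg_nonpos]
      exact div_nonneg (mul_nonneg (sq_nonneg _) (variance_nonneg _ _)) zero_le_two
    · refine (Finset.sum_le_sum fun i _ =>
        norm_charFun_sub_exp_le (hξ n i).aemeasurable (hM n i) (h0 n i) hsmall).trans (le_of_eq ?_)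
      rw [Finset.sum_const, Finset.card_univ, Fintype.card_fin, nsmul_eq_mul, habs]
      have hsn : (n : ℝ) = √(n : ℝ) ^ 2 := (Real.sq_sqrt (Nat.cast_nonneg n)).symm
      rw [mul_pow, hsn, Real.sqrt_sq hpos.le]
      field_simp

end clt

/-! ### Tensor products and kernel sections -/

namespace HSOp

variable {E F : Type*} [NormedAddCommGroup E] [InnerProductSpace ℝ E] [CompleteSpace E]
  [NormedAddCommGroup F] [InnerProductSpace ℝ F]

theorem inner_tensor_tensor (g g' : E) (f f' : F) :
    ⟪tensor g f, tensor g' f'⟫_ℝ = ⟪g, g'⟫_ℝ * ⟪f, f'⟫_ℝ := by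
  rw [inner_def, ← ((hsBasis E).hasSum_inner_mul_inner g g').tsum_eq, ← tsum_mul_right]
  refine tsum_congr fun i => ?_
  rw [tensor_apply, tensor_apply, real_inner_smul_left, real_inner_smul_right,
    real_inner_comm g' (hsBasis E i), mul_assoc]

theorem norm_tensor (g : E) (f : F) : ‖tensor g f‖ = ‖g‖ * ‖f‖ := by
  refine (sq_eq_sq₀ (norm_nonneg _) (by positivity)).1 ?_
  rw [← real_inner_self_eq_norm_sq, inner_tensor_tensor, real_inner_self_eq_norm_sq,
    real_inner_self_eq_norm_sq, mul_pow]

theorem tensor_add_left (g g' : E) (f : F) : tensor (g + g') f = tensor g f + tensor g' f := by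
  refine toCLM_injective (ContinuousLinearMap.ext fun h => ?_)
  rw [map_add, add_apply, tensor_apply, tensor_apply, tensor_apply, inner_add_left, add_smul]

theorem tensor_add_right (g : E) (f f' : F) : tensor g (f + f') = tensor g f + tensor g f' := by
  refine toCLM_injective (ContinuousLinearMap.ext fun h => ?_)
  rw [map_add, add_apply, tensor_apply, tensor_apply, tensor_apply, smul_add]

theorem tensor_smul_left (c : ℝ) (g : E) (f : F) : tensor (c • g) f = c • tensor g f := by
  refine toCLM_injective (ContinuousLinearMap.ext fun h => ?_)
  rw [map_smul, smul_apply, tensor_apply, tensor_apply, real_inner_smul_left,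
    mul_smul]

theorem tensor_smul_right (c : ℝ) (g : E) (f : F) : tensor g (c • f) = c • tensor g f := by
  refine toCLM_injective (ContinuousLinearMap.ext fun h => ?_)
  rw [map_smul, smul_apply, tensor_apply, tensor_apply, smul_comm]

variable (E F) in
/-- The tensor product `g ⊗ f` as a continuous bilinear map. -/
noncomputable def tensorL : E →L[ℝ] F →L[ℝ] HSOp E F :=
  (LinearMap.mk₂ ℝ tensor tensor_add_left tensor_smul_left tensor_add_right
    tensor_smul_right).mkContinuous₂ 1 fun g f => by
      rw [LinearMap.mk₂_apply, norm_tensor, one_mul]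

theorem tensorL_apply (g : E) (f : F) : tensorL E F g f = tensor g f := rfl

theorem tensor_sum_left {ι : Type*} (s : Finset ι) (g : ι → E) (f : F) :
    tensor (∑ i ∈ s, g i) f = ∑ i ∈ s, tensor (g i) f :=
  map_sum ((tensorL E F).flip f) g s

theorem tensor_sum_right {ι : Type*} (s : Finset ι) (g : E) (f : ι → F) :
    tensor g (∑ i ∈ s, f i) = ∑ i ∈ s, tensor g (f i) :=
  map_sum (tensorL E F g) f s

end HSOp

section kernel

variable (H : Type*) {𝒳 : Type*} [NormedAddCommGroup H] [InnerProductSpace ℝ H] [CompleteSpace H]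
  [RKHS ℝ H 𝒳 ℝ]

theorem inner_kernelSection_kernelSection (x x' : 𝒳) :
    ⟪kernelSection H x, kernelSection H x'⟫_ℝ = scalarKernel H x x' := by
  rw [real_inner_comm, inner_kernelSection, scalarKernel]

variable {H} in
/-- The feature map of a continuous kernel is continuous, since
`‖K(x, ·) - K(x₀, ·)‖² = K(x, x) - 2 K(x, x₀) + K(x₀, x₀)`. -/
theorem continuous_kernelSection [TopologicalSpace 𝒳]
    (hK : Continuous fun p : 𝒳 × 𝒳 => scalarKernel H p.1 p.2) :
    Continuous (kernelSection H : 𝒳 → H) := by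
  refine continuous_iff_continuousAt.2 fun x₀ => ?_
  rw [ContinuousAt, tendsto_iff_norm_sub_tendsto_zero]
  have e : ∀ x, ‖kernelSection H x - kernelSection H x₀‖ =
      √(scalarKernel H x x - 2 * scalarKernel H x x₀ + scalarKernel H x₀ x₀) := fun x => by
    rw [← inner_kernelSection_kernelSection, ← inner_kernelSection_kernelSection,
      ← inner_kernelSection_kernelSection, real_inner_self_eq_norm_sq, real_inner_self_eq_norm_sq,
      ← norm_sub_sq_real, Real.sqrt_sq (norm_nonneg _)]
  simp only [e]
  have hc : Continuous fun x =>
      √(scalarKernel H x x - 2 * scalarKernel H x x₀ + scalarKernel H x₀ x₀) := by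
    have h1 : Continuous fun x => scalarKernel H x x :=
      hK.comp (g := fun p : 𝒳 × 𝒳 => scalarKernel H p.1 p.2) (f := fun x => (x, x)) (by fun_prop)
    have h2 : Continuous fun x => scalarKernel H x x₀ :=
      hK.comp (g := fun p : 𝒳 × 𝒳 => scalarKernel H p.1 p.2) (f := fun x => (x, x₀)) (by fun_prop)
    fun_prop
  refine (hc.tendsto x₀).trans_eq ?_
  rw [show scalarKernel H x₀ x₀ - 2 * scalarKernel H x₀ x₀ + scalarKernel H x₀ x₀ = 0 by ring,
    Real.sqrt_zero]

end kernel

/-! ### Averages of independent centred variables in a Hilbert space -/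

section average

theorem tendstoInMeasure_zero_of_integral_abs_le {Ω : Type*} [MeasurableSpace Ω]
    {P : Measure Ω} {f : ℕ → Ω → ℝ} (hf : ∀ n, Integrable (f n) P)
    {b : ℕ → ℝ} (hb : Tendsto b atTop (𝓝 0)) (hfb : ∀ᶠ n in atTop, ∫ ω, |f n ω| ∂P ≤ b n) :
    TendstoInMeasure P f atTop 0 := by
  refine tendstoInMeasure_of_tendsto_eLpNorm one_ne_zero (fun n => (hf n).aestronglyMeasurable)
    aestronglyMeasurable_zero ?_
  have e : ∀ n, eLpNorm (f n - 0) 1 P = ENNReal.ofReal (∫ ω, |f n ω| ∂P) := fun n => by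
    rw [sub_zero, eLpNorm_one_eq_lintegral_enorm, ← ofReal_integral_norm_eq_lintegral_enorm (hf n)]
    rfl
  simp only [e]
  rw [← ENNReal.ofReal_zero]
  exact (ENNReal.continuous_ofReal.tendsto 0).comp
    (squeeze_zero' (.of_forall fun n => integral_nonneg fun ω => abs_nonneg _) hfb hb)

variable {Ω : Type*} [MeasurableSpace Ω] {P : Measure Ω} [IsProbabilityMeasure P]
  {E : Type*} [NormedAddCommGroup E] [InnerProductSpace ℝ E]

theorem integral_norm_sq_sum_le_of_orthogonal {ι : Type*} [Fintype ι] {D : ι → Ω → E}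
    (hD : ∀ i, AEStronglyMeasurable (D i) P) {M : ℝ} (hM : ∀ i ω, ‖D i ω‖ ≤ M)
    (horth : ∀ i j, i ≠ j → ∫ ω, ⟪D i ω, D j ω⟫_ℝ ∂P = 0) :
    ∫ ω, ‖∑ i, D i ω‖ ^ 2 ∂P ≤ Fintype.card ι * M ^ 2 := by
  classical
  have hM2 : ∀ i j ω, ‖⟪D i ω, D j ω⟫_ℝ‖ ≤ M ^ 2 := fun i j ω => by
    rw [sq]
    exact (norm_inner_le_norm _ _).trans (mul_le_mul (hM i ω) (hM j ω) (norm_nonneg _)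
      ((norm_nonneg _).trans (hM i ω)))
  have hint : ∀ i j, Integrable (fun ω => ⟪D i ω, D j ω⟫_ℝ) P := fun i j =>
    Integrable.of_bound ((hD i).inner (hD j)) (M ^ 2) (ae_of_all _ (hM2 i j))
  have e : ∀ ω, ‖∑ i, D i ω‖ ^ 2 = ∑ i, ∑ j, ⟪D i ω, D j ω⟫_ℝ := fun ω => by
    rw [← real_inner_self_eq_norm_sq, sum_inner]
    exact Finset.sum_congr rfl fun i _ => inner_sum _ _ _
  simp only [e]
  rw [integral_finsetSum _ fun i _ => integrable_finsetSum _ fun j _ => hint i j]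
  have e2 : ∀ i, ∫ ω, ∑ j, ⟪D i ω, D j ω⟫_ℝ ∂P = ∫ ω, ⟪D i ω, D i ω⟫_ℝ ∂P := fun i => by
    rw [integral_finsetSum _ fun j _ => hint i j]
    exact Finset.sum_eq_single i (fun j _ hj => horth i j hj.symm) (by simp)
  simp only [e2]
  refine (Finset.sum_le_card_nsmul _ _ (M ^ 2) fun i _ => ?_).trans_eq (by
    rw [Finset.card_univ, nsmul_eq_mul])
  have h := integral_mono (hint i i) (integrable_const (M ^ 2)) fun ω =>
    (le_abs_self _).trans (hM2 i i ω)
  simpa using h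

/-- The weighted average of `n` independent centred variables with bounded values in a Hilbert
space has second moment of order `1 / n`. -/
theorem integral_norm_sq_average_le [CompleteSpace E] {S : Type*} [MeasurableSpace S]
    {ζ : ℕ → Ω → S} (hζ : ∀ i, Measurable (ζ i)) (hindep : iIndepFun ζ P)
    {A : S → E} (hA : StronglyMeasurable A) {M : ℝ} (hM : ∀ s, ‖A s‖ ≤ M)
    (h0 : ∀ i, ∫ ω, A (ζ i ω) ∂P = 0) {n : ℕ} {c : Fin n → ℝ} {C : ℝ} (hc : ∀ i, |c i| ≤ C) :
    ∫ ω, ‖(n : ℝ)⁻¹ • ∑ i : Fin n, c i • A (ζ i ω)‖ ^ 2 ∂P ≤ (n : ℝ)⁻¹ * (C * M) ^ 2 := by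
  have hAi : ∀ i, AEStronglyMeasurable (fun ω => A (ζ i ω)) P := fun i =>
    (hA.comp_measurable (hζ i)).aestronglyMeasurable
  have h := integral_norm_sq_sum_le_of_orthogonal (P := P)
    (D := fun (i : Fin n) ω => c i • A (ζ i ω)) (fun i => (hAi i).const_smul _) (M := C * M)
    (fun i ω => by
      rw [norm_smul, Real.norm_eq_abs]
      exact mul_le_mul (hc i) (hM _) (norm_nonneg _) ((abs_nonneg _).trans (hc i)))
    (fun i j hij => by
      have hint : ∀ i, Integrable A (P.map (ζ i)) := fun i =>
        have := Measure.isProbabilityMeasure_map (hζ i).aemeasurable (μ := P)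
        Integrable.of_bound hA.aestronglyMeasurable M (ae_of_all _ hM)
      have hb := (hindep.indepFun (Fin.val_injective.ne hij)).integral_bilin_comp_comp
        (hζ i).aemeasurable (hζ j).aemeasurable (hint i) (hint j) (innerSL ℝ : E →L[ℝ] E →L[ℝ] ℝ)
      have hb' : ∫ ω, ⟪A (ζ i ω), A (ζ j ω)⟫_ℝ ∂P = 0 :=
        hb.trans (by rw [h0, h0]; exact inner_zero_left _)
      simp only [real_inner_smul_left, real_inner_smul_right]
      rw [integral_const_mul, integral_const_mul, hb', mul_zero, mul_zero])
  simp only [norm_smul, mul_pow, norm_inv, Real.norm_natCast]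
  rw [integral_const_mul]
  rw [Fintype.card_fin, mul_pow] at h
  rcases Nat.eq_zero_or_pos n with rfl | hn
  · simp
  · have hn' : (0 : ℝ) < n := by exact_mod_cast hn
    calc _ ≤ (n : ℝ)⁻¹ ^ 2 * (n * (C ^ 2 * M ^ 2)) := by gcongr
      _ = _ := by field_simp

end average

/-! ### Linearization of the estimator -/

section linearization

variable {E F : Type*} [NormedAddCommGroup E] [InnerProductSpace ℝ E] [CompleteSpace E]
  [NormedAddCommGroup F] [InnerProductSpace ℝ F]

open HSOp in
/-- The first order expansion of `‖μ‖² + ‖ν‖² - 2 ⟪μ', ν⟫`, with `ν = mY ⊗ mX`, under perturbations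
`δ` of `μ`, `δw` of `μ' = a μ`, and `dX`, `dY` of `mX`, `mY`: the remainder is quadratic in the
perturbations and linear in `a - 1`. -/
theorem abs_criterion_sub_linearization_le (μ δ δw : HSOp E F) (mY dY : E) (mX dX : F) (a B : ℝ)
    (hμ : ‖μ‖ ≤ B ^ 2) (hmY : ‖mY‖ ≤ B) (hmX : ‖mX‖ ≤ B) (hY : ‖mY + dY‖ ≤ B)
    (hX : ‖mX + dX‖ ≤ B) :
    |‖μ + δ‖ ^ 2 + ‖tensor (mY + dY) (mX + dX)‖ ^ 2 -
        2 * ⟪a • μ + δw, tensor (mY + dY) (mX + dX)⟫_ℝ - ‖μ - tensor mY mX‖ ^ 2 -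
        2 * (⟪δ, μ⟫_ℝ + ⟪tensor dY mX + tensor mY dX, tensor mY mX - μ⟫_ℝ -
          ⟪δw, tensor mY mX⟫_ℝ)| ≤
      ‖δ‖ ^ 2 + ‖δw‖ ^ 2 + 6 * B ^ 2 * (‖dX‖ ^ 2 + ‖dY‖ ^ 2) + 2 * B ^ 4 * |a - 1| := by
  have hB : 0 ≤ B := (norm_nonneg _).trans hmX
  set ν : HSOp E F := tensor mY mX with hν
  set l : HSOp E F := tensor dY mX + tensor mY dX with hl
  set q : HSOp E F := tensor dY dX with hq
  set N : HSOp E F := tensor (mY + dY) (mX + dX) with hN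
  have hNe : N = ν + (l + q) := by
    rw [hN, hν, hl, hq, tensor_add_left, tensor_add_right, tensor_add_right]; abel
  have hη : ‖l + q‖ ≤ B * (‖dX‖ + ‖dY‖) := by
    have e : l + q = tensor dY (mX + dX) + tensor mY dX := by
      rw [hl, hq, tensor_add_right]; abel
    rw [e]
    refine (norm_add_le _ _).trans ?_
    rw [norm_tensor, norm_tensor]
    have h1 := mul_le_mul_of_nonneg_left hX (norm_nonneg dY)
    have h2 := mul_le_mul_of_nonneg_right hmY (norm_nonneg dX)
    linarith
  have hηsq : ‖l + q‖ ^ 2 ≤ 2 * B ^ 2 * (‖dX‖ ^ 2 + ‖dY‖ ^ 2) := by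
    calc ‖l + q‖ ^ 2 ≤ (B * (‖dX‖ + ‖dY‖)) ^ 2 := by gcongr
      _ ≤ _ := by nlinarith [mul_nonneg (sq_nonneg B) (sq_nonneg (‖dX‖ - ‖dY‖))]
  have hqn : ‖q‖ ≤ (‖dX‖ ^ 2 + ‖dY‖ ^ 2) / 2 := by
    rw [hq, norm_tensor]; nlinarith [sq_nonneg (‖dX‖ - ‖dY‖)]
  have hνn : ‖ν‖ ≤ B ^ 2 := by
    rw [hν, norm_tensor, sq]; exact mul_le_mul hmY hmX (norm_nonneg _) hB
  have hNn : ‖N‖ ≤ B ^ 2 := by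
    rw [hN, norm_tensor, sq]; exact mul_le_mul hY hX (norm_nonneg _) hB
  have key : ‖μ + δ‖ ^ 2 + ‖N‖ ^ 2 - 2 * ⟪a • μ + δw, N⟫_ℝ - ‖μ - ν‖ ^ 2 -
      2 * (⟪δ, μ⟫_ℝ + ⟪l, ν - μ⟫_ℝ - ⟪δw, ν⟫_ℝ) =
      ‖δ‖ ^ 2 + ‖l + q‖ ^ 2 + 2 * ⟪q, ν - μ⟫_ℝ - 2 * ⟪δw, l + q⟫_ℝ -
        2 * ((a - 1) * ⟪μ, N⟫_ℝ) := by
    rw [hNe, norm_add_sq_real μ δ, norm_add_sq_real ν, norm_sub_sq_real]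
    simp only [inner_add_left, inner_add_right, inner_sub_right, real_inner_smul_left]
    rw [real_inner_comm μ δ, real_inner_comm l ν, real_inner_comm q ν, real_inner_comm μ l,
      real_inner_comm μ q]
    ring
  rw [key]
  have b1 : |⟪q, ν - μ⟫_ℝ| ≤ (‖dX‖ ^ 2 + ‖dY‖ ^ 2) / 2 * (2 * B ^ 2) :=
    (abs_real_inner_le_norm _ _).trans (mul_le_mul hqn
      ((norm_sub_le _ _).trans (by linarith)) (norm_nonneg _) (by positivity))
  have b2 : |⟪δw, l + q⟫_ℝ| ≤ (‖δw‖ ^ 2 + ‖l + q‖ ^ 2) / 2 :=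
    (abs_real_inner_le_norm _ _).trans (by nlinarith [sq_nonneg (‖δw‖ - ‖l + q‖)])
  have b3 : |(a - 1) * ⟪μ, N⟫_ℝ| ≤ |a - 1| * B ^ 4 := by
    rw [abs_mul]
    refine mul_le_mul_of_nonneg_left ((abs_real_inner_le_norm _ _).trans ?_) (abs_nonneg _)
    calc ‖μ‖ * ‖N‖ ≤ B ^ 2 * B ^ 2 := mul_le_mul hμ hNn (norm_nonneg _) (by positivity)
      _ = B ^ 4 := by ring
  rw [abs_le] at b1 b2 b3 ⊢
  have p1 := sq_nonneg ‖δ‖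
  have p2 := sq_nonneg ‖l + q‖
  constructor <;> linarith

end linearization

section estimator

variable {𝒳 𝒴 HX HY : Type*}
  [NormedAddCommGroup HX] [InnerProductSpace ℝ HX] [CompleteSpace HX] [RKHS ℝ HX 𝒳 ℝ]
  [NormedAddCommGroup HY] [InnerProductSpace ℝ HY] [CompleteSpace HY] [RKHS ℝ HY 𝒴 ℝ]

open HSOp in
/-- The estimator is the plug-in expression `‖μ̂‖² + ‖ν̂‖² - 2 ⟪μ̂_w, ν̂⟫`. -/
theorem hsicEstimator_eq {n : ℕ} (w : Fin n → ℝ) (x : Fin n → 𝒳) (y : Fin n → 𝒴) :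
    hsicEstimator (scalarKernel HX) (scalarKernel HY) w x y =
      ‖(n : ℝ)⁻¹ • ∑ i, tensor (kernelSection HY (y i)) (kernelSection HX (x i))‖ ^ 2 +
      ‖tensor ((n : ℝ)⁻¹ • ∑ i, kernelSection HY (y i))
        ((n : ℝ)⁻¹ • ∑ i, kernelSection HX (x i))‖ ^ 2 -
      2 * ⟪(n : ℝ)⁻¹ • ∑ i, w i • tensor (kernelSection HY (y i)) (kernelSection HX (x i)),
        tensor ((n : ℝ)⁻¹ • ∑ i, kernelSection HY (y i))
          ((n : ℝ)⁻¹ • ∑ i, kernelSection HX (x i))⟫_ℝ := by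
  simp only [← real_inner_self_eq_norm_sq, inner_tensor_tensor, real_inner_smul_left,
    real_inner_smul_right, sum_inner, inner_sum, inner_kernelSection_kernelSection, hsicEstimator]
  have e1 : (∑ i, ∑ j, ∑ q, ∑ r, scalarKernel HX (x i) (x j) * scalarKernel HY (y q) (y r)) =
      (∑ i, ∑ j, scalarKernel HY (y i) (y j)) * ∑ i, ∑ j, scalarKernel HX (x i) (x j) := by
    simp only [← Finset.mul_sum, ← Finset.sum_mul]; ring
  have e2 : (∑ i, ∑ j, ∑ q, w i * scalarKernel HX (x i) (x j) * scalarKernel HY (y i) (y q)) =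
      ∑ i, w i * ((∑ q, scalarKernel HY (y i) (y q)) * ∑ j, scalarKernel HX (x i) (x j)) := by
    refine Finset.sum_congr rfl fun i _ => ?_
    simp only [← Finset.mul_sum, ← Finset.sum_mul]; ring
  rw [e1, e2]
  simp only [← Finset.mul_sum, mul_left_comm _ (n : ℝ)⁻¹, mul_assoc (n : ℝ)⁻¹]
  rw [Finset.sum_comm (f := fun i j => scalarKernel HY (y j) (y i)),
    Finset.sum_comm (f := fun i j => scalarKernel HX (x j) (x i)),
    Finset.sum_comm (f := fun i j => scalarKernel HY (y j) (y i) * scalarKernel HX (x j) (x i))]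
  simp only [mul_comm (scalarKernel HX _ _) (scalarKernel HY _ _)]
  ring

theorem smul_add_smul_sum_smul_sub {G : Type*} [AddCommGroup G] [Module ℝ G] {n : ℕ}
    (w : Fin n → ℝ) (f : Fin n → G) (v : G) :
    ((n : ℝ)⁻¹ * ∑ i, w i) • v + (n : ℝ)⁻¹ • ∑ i, w i • (f i - v) =
      (n : ℝ)⁻¹ • ∑ i, w i • f i := by
  simp only [smul_sub, Finset.sum_sub_distrib, mul_smul, Finset.sum_smul]
  abel

theorem add_smul_sum_sub {G : Type*} [AddCommGroup G] [Module ℝ G] {n : ℕ} (hn : n ≠ 0)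
    (f : Fin n → G) (v : G) :
    v + (n : ℝ)⁻¹ • ∑ i, (1 : ℝ) • (f i - v) = (n : ℝ)⁻¹ • ∑ i, f i := by
  have h := smul_add_smul_sum_smul_sub (fun _ : Fin n => (1 : ℝ)) f v
  rw [Finset.sum_const, Finset.card_univ, Fintype.card_fin, nsmul_eq_mul, mul_one,
    inv_mul_cancel₀ (by exact_mod_cast hn), one_smul] at h
  simpa only [one_smul] using h

theorem norm_inv_smul_sum_le {G : Type*} [NormedAddCommGroup G] [NormedSpace ℝ G] {n : ℕ}
    (hn : n ≠ 0) (f : Fin n → G) {B : ℝ} (hB : ∀ i, ‖f i‖ ≤ B) :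
    ‖(n : ℝ)⁻¹ • ∑ i, f i‖ ≤ B := by
  have hn' : (0 : ℝ) < n := by exact_mod_cast Nat.pos_of_ne_zero hn
  rw [norm_smul, norm_inv, Real.norm_natCast, inv_mul_le_iff₀ hn']
  exact (norm_sum_le_of_le _ fun i _ => hB i).trans_eq (by simp)

variable {Ω : Type*} [MeasurableSpace Ω] (P : Measure Ω) (HX HY) (X : Ω → 𝒳) (Y : Ω → 𝒴)

open HSOp in
/-- `𝒰` as a linear function of the centred features. -/
theorem hsicU_eq (x : 𝒳) (y : 𝒴) : hsicU P HX HY X Y x y =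
    ⟪tensor (kernelSection HY y) (kernelSection HX x) - hsicMu P HX HY X Y,
      hsicMu P HX HY X Y⟫_ℝ +
    ⟪tensor (kernelSection HY y - meanEmbedding HY P Y) (meanEmbedding HX P X) +
      tensor (meanEmbedding HY P Y) (kernelSection HX x - meanEmbedding HX P X),
      hsicNu P HX HY X Y - hsicMu P HX HY X Y⟫_ℝ := by
  have e : tensor (kernelSection HY y) (meanEmbedding HX P X) +
      tensor (meanEmbedding HY P Y) (kernelSection HX x) - (2 : ℝ) • hsicNu P HX HY X Y =
      tensor (kernelSection HY y - meanEmbedding HY P Y) (meanEmbedding HX P X) +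
      tensor (meanEmbedding HY P Y) (kernelSection HX x - meanEmbedding HX P X) := by
    have e1 := tensor_add_left (kernelSection HY y - meanEmbedding HY P Y) (meanEmbedding HY P Y)
      (meanEmbedding HX P X)
    have e2 := tensor_add_right (meanEmbedding HY P Y)
      (kernelSection HX x - meanEmbedding HX P X) (meanEmbedding HX P X)
    rw [sub_add_cancel] at e1 e2
    rw [e1, e2, hsicNu, two_smul]
    abel
  rw [hsicU, e]

open HSOp in
/-- Along every sample, the estimation error is the average of `2 (𝒰 - wᵢ 𝒱)` up to squared norms
of (weighted) averages of centred features, and the error of the mean of the weights. -/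
theorem abs_hsicEstimator_sub_average_le {n : ℕ} (hn : n ≠ 0) (w : Fin n → ℝ) (x : Fin n → 𝒳)
    (y : Fin n → 𝒴) {B : ℝ} (hBX : ∀ x : 𝒳, ‖kernelSection HX x‖ ≤ B)
    (hBY : ∀ y : 𝒴, ‖kernelSection HY y‖ ≤ B) (hμ : ‖hsicMu P HX HY X Y‖ ≤ B ^ 2)
    (hmX : ‖meanEmbedding HX P X‖ ≤ B) (hmY : ‖meanEmbedding HY P Y‖ ≤ B) :
    |hsicEstimator (scalarKernel HX) (scalarKernel HY) w x y - hsic P HX HY X Y -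
        (n : ℝ)⁻¹ * ∑ i, 2 * (hsicU P HX HY X Y (x i) (y i) -
          w i * hsicV P HX HY X Y (x i) (y i))| ≤
      ‖(n : ℝ)⁻¹ • ∑ i, (1 : ℝ) • (tensor (kernelSection HY (y i)) (kernelSection HX (x i)) -
        hsicMu P HX HY X Y)‖ ^ 2 +
      ‖(n : ℝ)⁻¹ • ∑ i, w i • (tensor (kernelSection HY (y i)) (kernelSection HX (x i)) -
        hsicMu P HX HY X Y)‖ ^ 2 +
      6 * B ^ 2 *
        (‖(n : ℝ)⁻¹ • ∑ i, (1 : ℝ) • (kernelSection HX (x i) - meanEmbedding HX P X)‖ ^ 2 +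
        ‖(n : ℝ)⁻¹ • ∑ i, (1 : ℝ) • (kernelSection HY (y i) - meanEmbedding HY P Y)‖ ^ 2) +
      2 * B ^ 4 * |(n : ℝ)⁻¹ * ∑ i, w i - 1| := by
  set μ := hsicMu P HX HY X Y with hμd
  set mX := meanEmbedding HX P X with hmXd
  set mY := meanEmbedding HY P Y with hmYd
  set δ := (n : ℝ)⁻¹ • ∑ i, (1 : ℝ) •
    (tensor (kernelSection HY (y i)) (kernelSection HX (x i)) - μ) with hδ
  set δw := (n : ℝ)⁻¹ • ∑ i, w i •
    (tensor (kernelSection HY (y i)) (kernelSection HX (x i)) - μ) with hδw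
  set dX := (n : ℝ)⁻¹ • ∑ i, (1 : ℝ) • (kernelSection HX (x i) - mX) with hdX
  set dY := (n : ℝ)⁻¹ • ∑ i, (1 : ℝ) • (kernelSection HY (y i) - mY) with hdY
  have eδ : μ + δ = (n : ℝ)⁻¹ • ∑ i, tensor (kernelSection HY (y i)) (kernelSection HX (x i)) :=
    add_smul_sum_sub hn _ _
  have eX : mX + dX = (n : ℝ)⁻¹ • ∑ i, kernelSection HX (x i) := add_smul_sum_sub hn _ _
  have eY : mY + dY = (n : ℝ)⁻¹ • ∑ i, kernelSection HY (y i) := add_smul_sum_sub hn _ _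
  have eδw : ((n : ℝ)⁻¹ * ∑ i, w i) • μ + δw =
      (n : ℝ)⁻¹ • ∑ i, w i • tensor (kernelSection HY (y i)) (kernelSection HX (x i)) :=
    smul_add_smul_sum_smul_sub _ _ _
  have key := abs_criterion_sub_linearization_le μ δ δw mY dY mX dX ((n : ℝ)⁻¹ * ∑ i, w i) B
    hμ hmY hmX (by rw [eY]; exact norm_inv_smul_sum_le hn _ fun i => hBY _)
    (by rw [eX]; exact norm_inv_smul_sum_le hn _ fun i => hBX _)
  have eU : (n : ℝ)⁻¹ * ∑ i, hsicU P HX HY X Y (x i) (y i) =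
      ⟪δ, μ⟫_ℝ + ⟪tensor dY mX + tensor mY dX, tensor mY mX - μ⟫_ℝ := by
    simp only [hsicU_eq, ← hμd, ← hmXd, ← hmYd, hδ, hdX, hdY, one_smul, hsicNu, tensor_smul_left,
      tensor_smul_right, tensor_sum_left, tensor_sum_right]
    rw [← smul_add, ← Finset.sum_add_distrib, real_inner_smul_left, real_inner_smul_left,
      sum_inner, sum_inner, ← mul_add, ← Finset.sum_add_distrib]
  have eV : (n : ℝ)⁻¹ * ∑ i, w i * hsicV P HX HY X Y (x i) (y i) = ⟪δw, tensor mY mX⟫_ℝ := by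
    simp only [hsicV, ← hμd, hδw, real_inner_smul_left, sum_inner]
    rfl
  have e : (n : ℝ)⁻¹ * ∑ i, 2 * (hsicU P HX HY X Y (x i) (y i) -
      w i * hsicV P HX HY X Y (x i) (y i)) =
      2 * (⟪δ, μ⟫_ℝ + ⟪tensor dY mX + tensor mY dX, tensor mY mX - μ⟫_ℝ -
        ⟪δw, tensor mY mX⟫_ℝ) := by
    rw [← eU, ← eV, ← Finset.mul_sum, Finset.sum_sub_distrib]
    ring
  rw [hsicEstimator_eq, ← eδ, ← eX, ← eY, ← eδw, e]
  exact key

end estimator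

/-! ### Limit law of the leading term -/

section leading

theorem integral_comp_eq_of_identDistrib {Ω S : Type*} [MeasurableSpace Ω] {P : Measure Ω}
    [MeasurableSpace S] {E : Type*} [NormedAddCommGroup E] [NormedSpace ℝ E]
    {A : S → E} (hA : StronglyMeasurable A) {ζ ζ' : Ω → S} (h : IdentDistrib ζ ζ' P P) :
    ∫ ω, A (ζ ω) ∂P = ∫ ω, A (ζ' ω) ∂P := by
  rw [← integral_map h.aemeasurable_fst hA.aestronglyMeasurable, h.map_eq,
    integral_map h.aemeasurable_snd hA.aestronglyMeasurable]

variable {Ω S : Type*} [MeasurableSpace Ω] {P : Measure Ω} [IsProbabilityMeasure P]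
  [MeasurableSpace S]

/-- The central limit theorem for the sums `∑ i, 2 (u(ζᵢ) - wᵢ v(ζᵢ))` with bounded weights whose
first and second empirical moments converge. -/
theorem tendstoInDistribution_inv_sqrt_mul_sum_weighted {ζ : ℕ → Ω → S}
    (hζ : ∀ i, Measurable (ζ i)) (hindep : iIndepFun ζ P)
    (hident : ∀ i, IdentDistrib (ζ i) (ζ 0) P P) {u v : S → ℝ} (hu : Measurable u)
    (hv : Measurable v) {M : ℝ} (huM : ∀ s, |u s| ≤ M) (hvM : ∀ s, |v s| ≤ M)
    (hu0 : ∫ ω, u (ζ 0 ω) ∂P = 0) (hv0 : ∫ ω, v (ζ 0 ω) ∂P = 0)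
    {w : (n : ℕ) → Fin n → ℝ} {C a b : ℝ} (hw : ∀ n i, |w n i| ≤ C)
    (hw1 : Tendsto (fun n : ℕ => (n : ℝ)⁻¹ * ∑ i, w n i) atTop (𝓝 a))
    (hw2 : Tendsto (fun n : ℕ => (n : ℝ)⁻¹ * ∑ i, w n i ^ 2) atTop (𝓝 b)) :
    ∃ σsq : ℝ≥0, (σsq : ℝ) = 4 * Var[fun ω => u (ζ 0 ω); P] + 4 * b * Var[fun ω => v (ζ 0 ω); P] -
        8 * a * cov[fun ω => u (ζ 0 ω), fun ω => v (ζ 0 ω); P] ∧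
      TendstoInDistribution
        (fun (n : ℕ) ω => (√(n : ℝ))⁻¹ * ∑ i : Fin n, 2 * (u (ζ i ω) - w n i * v (ζ i ω)))
        atTop (id : ℝ → ℝ) (fun _ => P) (gaussianReal 0 σsq) := by
  set U : Ω → ℝ := fun ω => u (ζ 0 ω) with hU
  set V : Ω → ℝ := fun ω => v (ζ 0 ω) with hV
  have hmeas : ∀ c : ℝ, Measurable fun s => 2 * (u s - c * v s) := fun c =>
    (hu.sub (hv.const_mul c)).const_mul 2
  have hUL : MemLp U 2 P := MemLp.of_bound (hu.comp (hζ 0)).aestronglyMeasurable M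
    (ae_of_all _ fun ω => huM _)
  have hVL : MemLp V 2 P := MemLp.of_bound (hv.comp (hζ 0)).aestronglyMeasurable M
    (ae_of_all _ fun ω => hvM _)
  have hvar : ∀ (n : ℕ) (i : Fin n), Var[fun ω => 2 * (u (ζ i ω) - w n i * v (ζ i ω)); P] =
      4 * Var[U; P] + 4 * w n i ^ 2 * Var[V; P] - 8 * w n i * cov[U, V; P] := fun n i => by
    have h1 : Var[fun ω => 2 * (u (ζ i ω) - w n i * v (ζ i ω)); P] =
        Var[fun ω => 2 * (U ω - w n i * V ω); P] :=
      ((hident i).comp (hmeas (w n i))).variance_eq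
    rw [h1, variance_const_mul, variance_fun_sub hUL (hVL.const_mul _), variance_const_mul,
      covariance_const_mul_right]
    ring
  have hlim : Tendsto (fun n : ℕ => (n : ℝ)⁻¹ * ∑ i : Fin n,
      Var[fun ω => 2 * (u (ζ i ω) - w n i * v (ζ i ω)); P]) atTop
      (𝓝 (4 * Var[U; P] + 4 * b * Var[V; P] - 8 * a * cov[U, V; P])) := by
    have h := ((hw2.const_mul (4 * Var[V; P])).const_add (4 * Var[U; P])).sub
      (hw1.const_mul (8 * cov[U, V; P]))
    rw [show 4 * Var[U; P] + 4 * b * Var[V; P] - 8 * a * cov[U, V; P] =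
      4 * Var[U; P] + 4 * Var[V; P] * b - 8 * cov[U, V; P] * a by ring]
    refine h.congr' ?_
    filter_upwards [eventually_ne_atTop 0] with n hn
    have hn' : (n : ℝ) ≠ 0 := by exact_mod_cast hn
    simp only [hvar]
    have e : ∀ i, 4 * Var[U; P] + 4 * w n i ^ 2 * Var[V; P] - 8 * w n i * cov[U, V; P] =
        4 * Var[U; P] + 4 * Var[V; P] * w n i ^ 2 - 8 * cov[U, V; P] * w n i := fun i => by ring
    simp only [e]
    rw [Finset.sum_sub_distrib, Finset.sum_add_distrib, Finset.sum_const, Finset.card_univ,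
      Fintype.card_fin, nsmul_eq_mul, ← Finset.mul_sum, ← Finset.mul_sum]
    field_simp
  refine ⟨⟨_, ge_of_tendsto' hlim fun n => mul_nonneg (inv_nonneg.2 (Nat.cast_nonneg n))
    (Finset.sum_nonneg fun i _ => variance_nonneg _ _)⟩, rfl, ?_⟩
  refine tendstoInDistribution_inv_sqrt_mul_sum_of_bounded (M := 2 * (M + C * M))
    (fun n i => (hmeas (w n i)).comp (hζ i)) (fun n => ?_) (fun n i ω => ?_) (fun n i => ?_) hlim
  · exact (hindep.precomp Fin.val_injective).comp (fun i s => 2 * (u s - w n i * v s))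
      fun i => hmeas (w n i)
  · change |2 * (u (ζ i ω) - w n i * v (ζ i ω))| ≤ 2 * (M + C * M)
    rw [abs_mul, abs_two]
    refine mul_le_mul_of_nonneg_left ((abs_sub _ _).trans (add_le_add (huM _) ?_)) zero_le_two
    rw [abs_mul]
    exact mul_le_mul (hw n i) (hvM _) (abs_nonneg _) ((abs_nonneg _).trans (hw n i))
  · refine (integral_comp_eq_of_identDistrib (hmeas (w n i)).stronglyMeasurable (hident i)).trans ?_
    rw [integral_const_mul, integral_sub (hUL.integrable one_le_two)
        ((hVL.integrable one_le_two).const_mul _), integral_const_mul, hu0, hv0]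
    simp

end leading

/-! ### The criterion on compact spaces -/

section continuity

variable {𝒳 𝒴 : Type*} [TopologicalSpace 𝒳] [TopologicalSpace 𝒴] {HX HY : Type*}
  [NormedAddCommGroup HX] [InnerProductSpace ℝ HX] [CompleteSpace HX] [RKHS ℝ HX 𝒳 ℝ]
  [NormedAddCommGroup HY] [InnerProductSpace ℝ HY] [CompleteSpace HY] [RKHS ℝ HY 𝒴 ℝ]

theorem continuous_tensor_kernelSection
    (hHX : Continuous (kernelSection HX : 𝒳 → HX)) (hHY : Continuous (kernelSection HY : 𝒴 → HY)) :
    Continuous fun s : 𝒳 × 𝒴 => HSOp.tensor (kernelSection HY s.2) (kernelSection HX s.1) := by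
  simp only [← HSOp.tensorL_apply]
  fun_prop

variable {Ω : Type*} [MeasurableSpace Ω] {P : Measure Ω} {X : Ω → 𝒳} {Y : Ω → 𝒴}

theorem continuous_hsicU
    (hHX : Continuous (kernelSection HX : 𝒳 → HX)) (hHY : Continuous (kernelSection HY : 𝒴 → HY)) :
    Continuous fun s : 𝒳 × 𝒴 => hsicU P HX HY X Y s.1 s.2 := by
  have hT := continuous_tensor_kernelSection hHX hHY
  simp only [hsicU_eq, ← HSOp.tensorL_apply] at hT ⊢
  fun_prop

theorem continuous_hsicV
    (hHX : Continuous (kernelSection HX : 𝒳 → HX)) (hHY : Continuous (kernelSection HY : 𝒴 → HY)) :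
    Continuous fun s : 𝒳 × 𝒴 => hsicV P HX HY X Y s.1 s.2 := by
  have hT := continuous_tensor_kernelSection hHX hHY
  simp only [hsicV, ← HSOp.tensorL_apply] at hT ⊢
  fun_prop

theorem continuous_hsicEstimator
    (hHX : Continuous (kernelSection HX : 𝒳 → HX)) (hHY : Continuous (kernelSection HY : 𝒴 → HY))
    {n : ℕ} (w : Fin n → ℝ) :
    Continuous fun s : Fin n → 𝒳 × 𝒴 => hsicEstimator (scalarKernel HX) (scalarKernel HY) w
      (fun i => (s i).1) (fun i => (s i).2) := by
  simp only [hsicEstimator, ← inner_kernelSection_kernelSection]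
  fun_prop

end continuity

section compact

variable {Ω : Type*} [MeasurableSpace Ω] {P : Measure Ω} [IsProbabilityMeasure P]

theorem exists_norm_le_of_continuous {S E : Type*} [TopologicalSpace S] [CompactSpace S]
    [NormedAddCommGroup E] {A : S → E} (hA : Continuous A) : ∃ M, 0 ≤ M ∧ ∀ s, ‖A s‖ ≤ M := by
  obtain ⟨M, hM⟩ := isCompact_univ.exists_bound_of_continuousOn hA.continuousOn
  exact ⟨max M 0, le_max_right _ _, fun s => (hM s (Set.mem_univ s)).trans (le_max_left _ _)⟩

theorem integrable_continuous_comp {S E : Type*} [MetricSpace S] [CompactSpace S]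
    [MeasurableSpace S] [BorelSpace S] [NormedAddCommGroup E] {A : S → E} (hA : Continuous A)
    {ζ : Ω → S} (hζ : Measurable ζ) : Integrable (fun ω => A (ζ ω)) P := by
  obtain ⟨M, -, hM⟩ := exists_norm_le_of_continuous hA
  exact Integrable.of_bound (hA.stronglyMeasurable.comp_measurable hζ).aestronglyMeasurable M
    (ae_of_all _ fun ω => hM _)

/-- On a compact space, averages of a centred continuous feature with weights bounded by `C` have
second moments `O(1 / n)`, with a constant that does not depend on the weights. -/
theorem exists_integral_norm_sq_average_le {S E : Type*} [MetricSpace S] [CompactSpace S]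
    [MeasurableSpace S] [BorelSpace S] [NormedAddCommGroup E] [InnerProductSpace ℝ E]
    [CompleteSpace E] {A : S → E} (hA : Continuous A) {ζ : ℕ → Ω → S}
    (hζ : ∀ i, Measurable (ζ i)) (hindep : iIndepFun ζ P) (h0 : ∀ i, ∫ ω, A (ζ i ω) ∂P = 0)
    (C : ℝ) : ∃ c, ∀ (n : ℕ) (w : Fin n → ℝ), (∀ i, |w i| ≤ C) →
      Integrable (fun ω => ‖(n : ℝ)⁻¹ • ∑ i : Fin n, w i • A (ζ i ω)‖ ^ 2) P ∧
      ∫ ω, ‖(n : ℝ)⁻¹ • ∑ i : Fin n, w i • A (ζ i ω)‖ ^ 2 ∂P ≤ (n : ℝ)⁻¹ * c := by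
  obtain ⟨M, -, hM⟩ := exists_norm_le_of_continuous hA
  refine ⟨(C * M) ^ 2, fun n w hw => ⟨?_, ?_⟩⟩
  · -- the sample of size `n` is a random element of the compact space `Fin n → S`
    exact integrable_continuous_comp (S := Fin n → S)
      (A := fun s => ‖(n : ℝ)⁻¹ • ∑ i : Fin n, w i • A (s i)‖ ^ 2) (by fun_prop)
      (measurable_pi_lambda _ fun i => hζ i)
  · exact integral_norm_sq_average_le hζ hindep hA.stronglyMeasurable hM h0 hw

variable {𝒳 𝒴 : Type*} [MetricSpace 𝒳] [MeasurableSpace 𝒳] [BorelSpace 𝒳] [CompactSpace 𝒳]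
  [MetricSpace 𝒴] [MeasurableSpace 𝒴] [BorelSpace 𝒴] [CompactSpace 𝒴]
  {HX HY : Type*}
  [NormedAddCommGroup HX] [InnerProductSpace ℝ HX] [CompleteSpace HX] [RKHS ℝ HX 𝒳 ℝ]
  [NormedAddCommGroup HY] [InnerProductSpace ℝ HY] [CompleteSpace HY] [RKHS ℝ HY 𝒴 ℝ]
  {X : Ω → 𝒳} {Y : Ω → 𝒴}

theorem integral_tensor_kernelSection_sub_hsicMu (hX : Measurable X) (hY : Measurable Y)
    (hHX : Continuous (kernelSection HX : 𝒳 → HX)) (hHY : Continuous (kernelSection HY : 𝒴 → HY)) :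
    ∫ ω, (HSOp.tensor (kernelSection HY (Y ω)) (kernelSection HX (X ω)) - hsicMu P HX HY X Y) ∂P =
      0 := by
  rw [integral_sub (integrable_continuous_comp (continuous_tensor_kernelSection hHX hHY)
    (hX.prodMk hY)) (integrable_const _)]
  simp [hsicMu]

theorem integral_kernelSection_sub_meanEmbedding (hX : Measurable X)
    (hHX : Continuous (kernelSection HX : 𝒳 → HX)) :
    ∫ ω, (kernelSection HX (X ω) - meanEmbedding HX P X) ∂P = 0 := by
  rw [integral_sub (integrable_continuous_comp hHX hX) (integrable_const _)]
  simp [meanEmbedding]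

theorem integral_hsicV (hX : Measurable X) (hY : Measurable Y)
    (hHX : Continuous (kernelSection HX : 𝒳 → HX)) (hHY : Continuous (kernelSection HY : 𝒴 → HY)) :
    ∫ ω, hsicV P HX HY X Y (X ω) (Y ω) ∂P = 0 := by
  have hT := continuous_tensor_kernelSection hHX hHY
  have i1 : Integrable (fun ω => HSOp.tensor (kernelSection HY (Y ω)) (kernelSection HX (X ω)) -
      hsicMu P HX HY X Y) P :=
    (integrable_continuous_comp hT (hX.prodMk hY)).sub (integrable_const _)
  have h := integral_inner (𝕜 := ℝ) i1 (hsicNu P HX HY X Y)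
  rw [integral_tensor_kernelSection_sub_hsicMu hX hY hHX hHY, inner_zero_right] at h
  rw [← h]
  exact integral_congr_ae (ae_of_all _ fun ω => real_inner_comm _ _)

theorem integral_hsicU (hX : Measurable X) (hY : Measurable Y)
    (hHX : Continuous (kernelSection HX : 𝒳 → HX)) (hHY : Continuous (kernelSection HY : 𝒴 → HY)) :
    ∫ ω, hsicU P HX HY X Y (X ω) (Y ω) ∂P = 0 := by
  have hT := continuous_tensor_kernelSection hHX hHY
  have i1 : Integrable (fun ω => HSOp.tensor (kernelSection HY (Y ω)) (kernelSection HX (X ω)) -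
      hsicMu P HX HY X Y) P :=
    (integrable_continuous_comp hT (hX.prodMk hY)).sub (integrable_const _)
  have i2 : Integrable (fun ω => kernelSection HX (X ω) - meanEmbedding HX P X) P :=
    (integrable_continuous_comp hHX hX).sub (integrable_const _)
  have i3 : Integrable (fun ω => kernelSection HY (Y ω) - meanEmbedding HY P Y) P :=
    (integrable_continuous_comp hHY hY).sub (integrable_const _)
  -- the three terms of `𝒰` are continuous linear functionals of centred features
  let φ₁ : HSOp HY HX →L[ℝ] ℝ := innerSL ℝ (hsicMu P HX HY X Y)
  let ψ : HSOp HY HX →L[ℝ] ℝ := innerSL ℝ (hsicNu P HX HY X Y - hsicMu P HX HY X Y)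
  let φ₂ : HY →L[ℝ] ℝ := ψ.comp ((HSOp.tensorL HY HX).flip (meanEmbedding HX P X))
  let φ₃ : HX →L[ℝ] ℝ := ψ.comp (HSOp.tensorL HY HX (meanEmbedding HY P Y))
  have e : ∀ ω, hsicU P HX HY X Y (X ω) (Y ω) =
      φ₁ (HSOp.tensor (kernelSection HY (Y ω)) (kernelSection HX (X ω)) - hsicMu P HX HY X Y) +
      (φ₂ (kernelSection HY (Y ω) - meanEmbedding HY P Y) +
        φ₃ (kernelSection HX (X ω) - meanEmbedding HX P X)) := fun ω => by
    rw [hsicU_eq, inner_add_left, real_inner_comm, real_inner_comm (hsicNu P HX HY X Y - _),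
      real_inner_comm (hsicNu P HX HY X Y - _)]
    rfl
  simp only [e]
  have j2 := φ₂.integrable_comp i3
  have j3 := φ₃.integrable_comp i2
  have j23 : Integrable (fun ω => φ₂ (kernelSection HY (Y ω) - meanEmbedding HY P Y) +
      φ₃ (kernelSection HX (X ω) - meanEmbedding HX P X)) P := j2.add j3
  rw [integral_add (φ₁.integrable_comp i1) j23, integral_add j2 j3,
    φ₁.integral_comp_comm i1, φ₂.integral_comp_comm i3, φ₃.integral_comp_comm i2,
    integral_tensor_kernelSection_sub_hsicMu hX hY hHX hHY,
    integral_kernelSection_sub_meanEmbedding hX hHX,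
    integral_kernelSection_sub_meanEmbedding hY hHY]
  simp

/-- The estimation error differs from the average of `2 (𝒰 - wᵢ 𝒱)` by `o(1 / √n)` in
probability. -/
theorem tendstoInMeasure_hsicEstimator_sub_average (hX : Measurable X) (hY : Measurable Y)
    (hHX : Continuous (kernelSection HX : 𝒳 → HX)) (hHY : Continuous (kernelSection HY : 𝒴 → HY))
    {ζ : ℕ → Ω → 𝒳 × 𝒴} (hζ : ∀ i, Measurable (ζ i)) (hindep : iIndepFun ζ P)
    (hident : ∀ i, IdentDistrib (ζ i) (fun ω => (X ω, Y ω)) P P)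
    {w : (n : ℕ) → Fin n → ℝ} {C τ : ℝ} (hw : ∀ n i, |w n i| ≤ C)
    (hw1 : ∀ᶠ n : ℕ in atTop, (n : ℝ) * |(n : ℝ)⁻¹ * ∑ i, w n i - 1| ≤ τ) :
    TendstoInMeasure P (fun (n : ℕ) ω => √(n : ℝ) *
      (hsicEstimator (scalarKernel HX) (scalarKernel HY) (w n) (fun i : Fin n => (ζ i ω).1)
        (fun i : Fin n => (ζ i ω).2) - hsic P HX HY X Y -
        (n : ℝ)⁻¹ * ∑ i : Fin n, 2 * (hsicU P HX HY X Y (ζ i ω).1 (ζ i ω).2 -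
          w n i * hsicV P HX HY X Y (ζ i ω).1 (ζ i ω).2))) atTop 0 := by
  have hT := continuous_tensor_kernelSection hHX hHY
  obtain ⟨BX, hBX0, hBX'⟩ := exists_norm_le_of_continuous hHX
  obtain ⟨BY, hBY0, hBY'⟩ := exists_norm_le_of_continuous hHY
  set B := max BX BY
  have hB0 : 0 ≤ B := hBX0.trans (le_max_left _ _)
  have hBX : ∀ x : 𝒳, ‖kernelSection HX x‖ ≤ B := fun x => (hBX' x).trans (le_max_left _ _)
  have hBY : ∀ y : 𝒴, ‖kernelSection HY y‖ ≤ B := fun y => (hBY' y).trans (le_max_right _ _)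
  have hmX : ‖meanEmbedding HX P X‖ ≤ B :=
    (norm_integral_le_of_norm_le_const (ae_of_all _ fun ω => hBX _)).trans (by simp)
  have hmY : ‖meanEmbedding HY P Y‖ ≤ B :=
    (norm_integral_le_of_norm_le_const (ae_of_all _ fun ω => hBY _)).trans (by simp)
  have hTB : ∀ s : 𝒳 × 𝒴, ‖HSOp.tensor (kernelSection HY s.2) (kernelSection HX s.1)‖ ≤ B ^ 2 :=
    fun s => by
      rw [HSOp.norm_tensor, sq]; exact mul_le_mul (hBY _) (hBX _) (norm_nonneg _) hB0
  have hμ : ‖hsicMu P HX HY X Y‖ ≤ B ^ 2 :=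
    (norm_integral_le_of_norm_le_const (ae_of_all _ fun ω => hTB (X ω, Y ω))).trans (by simp)
  -- the centred features
  let AT : 𝒳 × 𝒴 → HSOp HY HX := fun s =>
    HSOp.tensor (kernelSection HY s.2) (kernelSection HX s.1) - hsicMu P HX HY X Y
  let AX : 𝒳 × 𝒴 → HX := fun s => kernelSection HX s.1 - meanEmbedding HX P X
  let AY : 𝒳 × 𝒴 → HY := fun s => kernelSection HY s.2 - meanEmbedding HY P Y
  have cT : Continuous AT := hT.sub continuous_const
  have cX : Continuous AX := (hHX.comp continuous_fst).sub continuous_const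
  have cY : Continuous AY := (hHY.comp continuous_snd).sub continuous_const
  have zT : ∀ i, ∫ ω, AT (ζ i ω) ∂P = 0 := fun i =>
    (integral_comp_eq_of_identDistrib cT.stronglyMeasurable (hident i)).trans
      (integral_tensor_kernelSection_sub_hsicMu hX hY hHX hHY)
  have zX : ∀ i, ∫ ω, AX (ζ i ω) ∂P = 0 := fun i =>
    (integral_comp_eq_of_identDistrib cX.stronglyMeasurable (hident i)).trans
      (integral_kernelSection_sub_meanEmbedding hX hHX)
  have zY : ∀ i, ∫ ω, AY (ζ i ω) ∂P = 0 := fun i =>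
    (integral_comp_eq_of_identDistrib cY.stronglyMeasurable (hident i)).trans
      (integral_kernelSection_sub_meanEmbedding hY hHY)
  obtain ⟨KT, hKT⟩ := exists_integral_norm_sq_average_le cT hζ hindep zT 1
  obtain ⟨KW, hKW⟩ := exists_integral_norm_sq_average_le cT hζ hindep zT C
  obtain ⟨KX, hKX⟩ := exists_integral_norm_sq_average_le cX hζ hindep zX 1
  obtain ⟨KY, hKY⟩ := exists_integral_norm_sq_average_le cY hζ hindep zY 1
  have hone : ∀ n : ℕ, ∀ i : Fin n, |(fun _ => (1 : ℝ)) i| ≤ 1 := fun n i => by simp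
  set K : ℝ := KT + KW + 6 * B ^ 2 * (KX + KY) + 2 * B ^ 4 * τ with hK
  have hint : ∀ n : ℕ, Integrable (fun ω => √(n : ℝ) *
      (hsicEstimator (scalarKernel HX) (scalarKernel HY) (w n) (fun i : Fin n => (ζ i ω).1)
        (fun i : Fin n => (ζ i ω).2) - hsic P HX HY X Y -
        (n : ℝ)⁻¹ * ∑ i : Fin n, 2 * (hsicU P HX HY X Y (ζ i ω).1 (ζ i ω).2 -
          w n i * hsicV P HX HY X Y (ζ i ω).1 (ζ i ω).2))) P := fun n => by
    have c1 := continuous_hsicEstimator hHX hHY (w n)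
    have c2 := continuous_hsicU (P := P) (X := X) (Y := Y) hHX hHY
    have c3 := continuous_hsicV (P := P) (X := X) (Y := Y) hHX hHY
    exact integrable_continuous_comp (S := Fin n → 𝒳 × 𝒴) (A := fun s => √(n : ℝ) *
      (hsicEstimator (scalarKernel HX) (scalarKernel HY) (w n) (fun i : Fin n => (s i).1)
        (fun i : Fin n => (s i).2) - hsic P HX HY X Y -
        (n : ℝ)⁻¹ * ∑ i : Fin n, 2 * (hsicU P HX HY X Y (s i).1 (s i).2 -
          w n i * hsicV P HX HY X Y (s i).1 (s i).2)))
      (continuous_const.mul ((c1.sub continuous_const).sub (continuous_const.mul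
        (continuous_finsetSum _ fun i _ => continuous_const.mul
          ((c2.comp (continuous_apply i)).sub
            (continuous_const.mul (c3.comp (continuous_apply i))))))))
      (measurable_pi_lambda _ fun i => hζ i)
  refine tendstoInMeasure_zero_of_integral_abs_le hint (b := fun n => (√(n : ℝ))⁻¹ * K) ?_ ?_
  · simpa using (Real.tendsto_sqrt_atTop.comp
      tendsto_natCast_atTop_atTop).inv_tendsto_atTop.mul_const K
  filter_upwards [eventually_ne_atTop 0, hw1] with n hn hn1
  have hpos : (0 : ℝ) < n := by exact_mod_cast Nat.pos_of_ne_zero hn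
  have hspos : 0 < √(n : ℝ) := Real.sqrt_pos.2 hpos
  obtain ⟨iT, bT⟩ := hKT n (fun _ => 1) (hone n)
  obtain ⟨iW, bW⟩ := hKW n (w n) (hw n)
  obtain ⟨iX, bX⟩ := hKX n (fun _ => 1) (hone n)
  obtain ⟨iY, bY⟩ := hKY n (fun _ => 1) (hone n)
  have iXY := (iX.add iY).const_mul (6 * B ^ 2)
  have hbound := integral_mono (hint n).abs
    (((((iT.add iW).add iXY).add (integrable_const
      (2 * B ^ 4 * |(n : ℝ)⁻¹ * ∑ i, w n i - 1|))).const_mul √(n : ℝ))) fun ω => by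
        change |√(n : ℝ) * _| ≤ √(n : ℝ) * _
        rw [abs_mul, abs_of_pos hspos]
        exact mul_le_mul_of_nonneg_left (abs_hsicEstimator_sub_average_le HX HY P X Y hn (w n)
          (fun i => (ζ i ω).1) (fun i => (ζ i ω).2) hBX hBY hμ hmX hmY) hspos.le
  refine hbound.trans ?_
  rw [integral_const_mul, integral_add' ((iT.add iW).add iXY) (integrable_const _),
    integral_add' (iT.add iW) iXY, integral_add' iT iW, integral_const_mul, integral_add' iX iY,
    integral_const, probReal_univ, one_smul]
  have hwn : |(n : ℝ)⁻¹ * ∑ i, w n i - 1| ≤ (n : ℝ)⁻¹ * τ :=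
    (le_inv_mul_iff₀ hpos).2 hn1
  have hfin : √(n : ℝ) * ((n : ℝ)⁻¹ * K) = (√(n : ℝ))⁻¹ * K := by
    have h : (n : ℝ)⁻¹ = (√(n : ℝ))⁻¹ * (√(n : ℝ))⁻¹ := by
      rw [← mul_inv, Real.mul_self_sqrt hpos.le]
    rw [h]; field_simp
  rw [← hfin]
  refine mul_le_mul_of_nonneg_left ?_ hspos.le
  have h6 := mul_le_mul_of_nonneg_left (add_le_add bX bY) (show 0 ≤ 6 * B ^ 2 by positivity)
  have h7 := mul_le_mul_of_nonneg_left hwn (show 0 ≤ 2 * B ^ 4 by positivity)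
  have h8 : (n : ℝ)⁻¹ * K = (n : ℝ)⁻¹ * KT + (n : ℝ)⁻¹ * KW +
      6 * B ^ 2 * ((n : ℝ)⁻¹ * KX + (n : ℝ)⁻¹ * KY) + 2 * B ^ 4 * ((n : ℝ)⁻¹ * τ) := by
    rw [hK]; ring
  rw [h8]
  exact add_le_add (add_le_add (add_le_add bT bW) h6) h7

end compact

theorem theorem1
    {Ω 𝒳 𝒴 : Type*} [MeasurableSpace Ω] (P : Measure Ω) [IsProbabilityMeasure P]
    [MetricSpace 𝒳] [MeasurableSpace 𝒳] [BorelSpace 𝒳]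
    [MetricSpace 𝒴] [MeasurableSpace 𝒴] [BorelSpace 𝒴]
    -- the reproducing kernel Hilbert spaces, with kernels `K = scalarKernel HX`,
    -- `L = scalarKernel HY`
    (HX HY : Type*)
    [NormedAddCommGroup HX] [InnerProductSpace ℝ HX] [CompleteSpace HX] [RKHS ℝ HX 𝒳 ℝ]
    [NormedAddCommGroup HY] [InnerProductSpace ℝ HY] [CompleteSpace HY] [RKHS ℝ HY 𝒴 ℝ]
    -- the random variables `X`, `Y` and the i.i.d. sample of `(X, Y)`
    (X : Ω → 𝒳) (Y : Ω → 𝒴) (hX : Measurable X) (hY : Measurable Y)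
    (Xs : ℕ → Ω → 𝒳) (Ys : ℕ → Ω → 𝒴)
    (hXs : ∀ i, Measurable (Xs i)) (hYs : ∀ i, Measurable (Ys i))
    (hindep : iIndepFun (fun (i : ℕ) (ω : Ω) => (Xs i ω, Ys i ω)) P)
    (hident : ∀ i, IdentDistrib (fun ω => (Xs i ω, Ys i ω)) (fun ω => (X ω, Y ω)) P P)
    -- the weights: `w γ r i` is the weight of the observation `i` in a sample of size `r`
    (w : ℝ → (r : ℕ) → Fin r → ℝ) (wlim : ℝ → ℝ)
    (hwpos : ∀ γ ∈ Set.Ioc (0 : ℝ) 1, ∀ r, ∀ i : Fin r, 0 < w γ r i)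
    -- (A1)
    (hK : BddAbove (Set.range fun p : 𝒳 × 𝒳 => scalarKernel HX p.1 p.2))
    (hL : BddAbove (Set.range fun p : 𝒴 × 𝒴 => scalarKernel HY p.1 p.2))
    -- (A2)
    [CompactSpace 𝒳] [CompactSpace 𝒴]
    (hHX : IsUniversalRKHS HX) (hHY : IsUniversalRKHS HY)
    -- (A3)
    (hA3 : ∀ γ ∈ Set.Ioc (0 : ℝ) 1, ∃ τ > (0 : ℝ), ∃ n₀ : ℕ, ∀ r > n₀,
      (r : ℝ) * |1 / (r : ℝ) * ∑ i, w γ r i - 1| ≤ τ)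
    -- (A4)
    (hA4 : ∃ C > (0 : ℝ), ∀ γ ∈ Set.Ioc (0 : ℝ) 1, ∀ r, ∀ i : Fin r, w γ r i < C)
    -- (A5)
    (hA5 : ∀ γ ∈ Set.Ioc (0 : ℝ) 1,
      Tendsto (fun r : ℕ => 1 / (r : ℝ) * ∑ i, w γ r i ^ 2) atTop (𝓝 (wlim γ ^ 2)) ∧
        1 < wlim γ ^ 2)
    (γ : ℝ) (hγ : γ ∈ Set.Ioc (0 : ℝ) 1) :
    ∃ σsq : ℝ≥0,
      (σsq : ℝ) =
        4 * Var[fun ω => hsicU P HX HY X Y (Xs 0 ω) (Ys 0 ω); P] +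
        4 * wlim γ ^ 2 * Var[fun ω => hsicV P HX HY X Y (Xs 0 ω) (Ys 0 ω); P] -
        8 * cov[fun ω => hsicU P HX HY X Y (Xs 0 ω) (Ys 0 ω),
          fun ω => hsicV P HX HY X Y (Xs 0 ω) (Ys 0 ω); P] ∧
      TendstoInDistribution
        (fun (n : ℕ) (ω : Ω) => √(n : ℝ) *
          (hsicEstimator (scalarKernel HX) (scalarKernel HY) (w γ n)
            (fun i : Fin n => Xs i ω) (fun i : Fin n => Ys i ω) - hsic P HX HY X Y))
        atTop (id : ℝ → ℝ) (fun _ => P) (gaussianReal 0 σsq) := by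
  have cX : Continuous (kernelSection HX : 𝒳 → HX) := continuous_kernelSection hHX.1
  have cY : Continuous (kernelSection HY : 𝒴 → HY) := continuous_kernelSection hHY.1
  have hζ : ∀ i, Measurable fun ω => (Xs i ω, Ys i ω) := fun i => (hXs i).prodMk (hYs i)
  obtain ⟨C, -, hC⟩ := hA4
  obtain ⟨τ, -, n₀, hτ⟩ := hA3 γ hγ
  have hw : ∀ n i, |w γ n i| ≤ C := fun n i => by
    rw [abs_of_pos (hwpos γ hγ n i)]; exact (hC γ hγ n i).le
  have hτ' : ∀ᶠ n : ℕ in atTop, (n : ℝ) * |(n : ℝ)⁻¹ * ∑ i, w γ n i - 1| ≤ τ := by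
    filter_upwards [eventually_gt_atTop n₀] with n hn
    simpa only [one_div] using hτ n hn
  -- the mean of the weights is `1 + O(1 / n)`, which is more than its convergence: after
  -- multiplication by `√n` its deviation from `1` is still negligible
  have hw1 : Tendsto (fun n : ℕ => (n : ℝ)⁻¹ * ∑ i, w γ n i) atTop (𝓝 1) := by
    rw [tendsto_iff_dist_tendsto_zero]
    have h0 : Tendsto (fun n : ℕ => (n : ℝ)⁻¹ * τ) atTop (𝓝 0) := by
      simpa using (tendsto_inv_atTop_zero.comp tendsto_natCast_atTop_atTop).mul_const τ
    refine squeeze_zero' (.of_forall fun n => dist_nonneg) ?_ h0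
    filter_upwards [hτ', eventually_gt_atTop 0] with n hn hn0
    rw [Real.dist_eq]
    exact (le_inv_mul_iff₀ (by exact_mod_cast hn0)).2 hn
  have hw2 : Tendsto (fun n : ℕ => (n : ℝ)⁻¹ * ∑ i, w γ n i ^ 2) atTop (𝓝 (wlim γ ^ 2)) := by
    simpa only [one_div] using (hA5 γ hγ).1
  have cU := continuous_hsicU (P := P) (X := X) (Y := Y) cX cY
  have cV := continuous_hsicV (P := P) (X := X) (Y := Y) cX cY
  obtain ⟨MU, -, hMU⟩ := exists_norm_le_of_continuous cU
  obtain ⟨MV, -, hMV⟩ := exists_norm_le_of_continuous cV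
  obtain ⟨σsq, hσ, hlim⟩ := tendstoInDistribution_inv_sqrt_mul_sum_weighted hζ hindep
    (fun i => (hident i).trans (hident 0).symm) cU.measurable cV.measurable (M := max MU MV)
    (fun s => (hMU s).trans (le_max_left _ _)) (fun s => (hMV s).trans (le_max_right _ _))
    ((integral_comp_eq_of_identDistrib cU.stronglyMeasurable (hident 0)).trans
      (integral_hsicU hX hY cX cY))
    ((integral_comp_eq_of_identDistrib cV.stronglyMeasurable (hident 0)).trans
      (integral_hsicV hX hY cX cY)) hw hw1 hw2
  refine ⟨σsq, by rw [hσ, mul_one], ?_⟩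
  refine tendstoInDistribution_of_tendstoInMeasure_sub _ _ hlim ?_ fun n => ?_
  · refine (tendstoInMeasure_hsicEstimator_sub_average hX hY cX cY hζ hindep hident hw hτ').congr'
      (.of_forall fun n => ae_of_all _ fun ω => ?_) ae_eq_rfl
    -- also true for `n = 0`, where both sides vanish
    have hn : √(n : ℝ) * (n : ℝ)⁻¹ = (√(n : ℝ))⁻¹ := by
      rw [← div_eq_mul_inv, Real.sqrt_div_self', one_div]
    simp only [Pi.sub_apply]
    rw [mul_sub, ← mul_assoc, hn]
  · exact (((continuous_hsicEstimator cX cY (w γ n)).measurable.comp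
      (measurable_pi_lambda _ fun i : Fin n => hζ i)).sub_const _ |>.const_mul _).aemeasurable
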